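/- Let $K$ be a field with $\operatorname{char} K\neq 2$. A hyperelliptic curve of genus $g\ge 1$ over $K$ is here the smooth projective curve with affine equation $C: Y^2=f(X)$, where $f\in K[X]$ has no multiple root in $\overline K$ and has degree $2g+1$ or $2g+2$. Let $\alpha_1,\dots,\alpha_{2g+2}$ be a labelling of the roots of $f$ in $\overline K$, together with $\infty$ if $\deg f=2g+1$. For $i\ne j$ the symmetric ratios of $C$ are the elements $$p_{ijt}=\zeta_t\sqrt[2g]{\prod_{k\neq i,j}\frac{\alpha_j-\alpha_k}{\alpha_i-\alpha_k}}\in\overline K,$$ where $\zeta_t$ runs through the $4g$-th roots of unity in $\overline K$, and the symmetric roots of $C$ are $$\ell_{ijtk}=p_{ijt}\,\frac{\alpha_i-\alpha_k}{\alpha_j-\alpha_k}\qquad (k\neq i,j);$$ in these formulas every factor $\alpha_r-\alpha_s$ in which $\alpha_r$ or $\alpha_s$ is $\infty$ is replaced by $1$. Let $C: Y^2=f(X)$ and $C': Y^2=f'(X)$ be hyperelliptic curves over $K$, of genus $g$ and $g'$, with labelled roots $\alpha_1,\dots,\alpha_{2g+2}$ and $\alpha'_1,\dots,\alpha'_{2g'+2}$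 and symmetric roots $\ell_{ijtk}$ and $\ell'_{ijtk}$. (1) If $C$ and $C'$ are isomorphic over $K$, or over any extension field $L$ of $K$, then there is a bijection $e:\{1,\dots,2g+2\}\to\{1,\dots,2g'+2\}$ (so that $g=g'$) such that, for all $i\neq j$, the sets of families $$\{(\ell_{ijtk})_{k\neq i,j}\;:\;t\}\quad\text{and}\quad\{(\ell'_{e(i)e(j)te(k)})_{k\neq i,j}\;:\;t\}$$ are equal. (2) The symmetric roots are invariants of the curve together with the labelling of its Weierstrass points: if $\varphi:C\to C'$ is an isomorphism over $\overline K$ and $e:\{1,\dots,2g+2\}\to\{1,\dots,2g'+2\}$ is a bijection such that, for every $i$, $\varphi$ takes the Weierstrass point of $C$ over $\alpha_i$ to the Weierstrass point of $C'$ over $\alpha'_{e(i)}$, then the equalities in (1) hold for this $e$. -/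

import Mathlib

open Polynomial

/-- A hyperelliptic curve `Y ^ 2 = f(X)` of genus `g ≥ 1` over a field `k` (of characteristic
different from 2): `f` has no multiple root in an algebraic closure of `k` and has degree `2g + 1`
or `2g + 2`. It stands for the smooth projective curve with this affine equation. -/
structure HyperellipticCurve (k : Type*) [Field k] where
  genus : ℕ
  one_le_genus : 1 ≤ genus
  f : k[X]
  separable : f.Separable
  natDegree_f : f.natDegree = 2 * genus + 1 ∨ f.natDegree = 2 * genus + 2

namespace HyperellipticCurve

/-- The same equation, over an extension field. -/
noncomputable def baseChange {k : Type*} [Field k] (C : HyperellipticCurve k)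
    (L : Type*) [Field L] [Algebra k L] : HyperellipticCurve L where
  genus := C.genus
  one_le_genus := C.one_le_genus
  f := C.f.map (algebraMap k L)
  separable := C.separable.map
  natDegree_f := by
    rw [Polynomial.natDegree_map]
    exact C.natDegree_f

/-- The polynomial `T ^ 2 - f(x)` over the rational function field `k(x)`. -/
noncomputable def definingPolynomial {k : Type*} [Field k] (C : HyperellipticCurve k) :
    (RatFunc k)[X] :=
  X ^ 2 - Polynomial.C (algebraMap k[X] (RatFunc k) C.f)

theorem irreducible_definingPolynomial {k : Type*} [Field k] (C : HyperellipticCurve k) :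
    Irreducible C.definingPolynomial := by
  unfold definingPolynomial
  refine X_pow_sub_C_irreducible_of_prime Nat.prime_two ?_
  intro b hb
  have hint : IsIntegral k[X] b := by
    refine IsIntegral.of_pow (n := 2) (by norm_num) ?_
    rw [hb]
    exact isIntegral_algebraMap
  obtain ⟨q, rfl⟩ := IsIntegrallyClosed.isIntegral_iff.mp hint
  rw [← map_pow] at hb
  have hq : q ^ 2 = C.f := IsFractionRing.injective k[X] (RatFunc k) hb
  have hu : IsUnit q := by
    apply C.separable.squarefree q
    rw [← hq, pow_two]
  have h0 : C.f.natDegree = 0 := by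
    rw [← hq, Polynomial.natDegree_pow, Polynomial.natDegree_eq_zero_of_isUnit hu]
  have h1 := C.one_le_genus
  rcases C.natDegree_f with h | h <;> omega

noncomputable instance {k : Type*} [Field k] (C : HyperellipticCurve k) :
    Fact (Irreducible C.definingPolynomial) :=
  ⟨C.irreducible_definingPolynomial⟩

/-- The function field `k(x)(y)`, `y ^ 2 = f(x)`, of the curve. -/
noncomputable abbrev FunctionField {k : Type*} [Field k] (C : HyperellipticCurve k) : Type _ :=
  AdjoinRoot C.definingPolynomial

/-- The coordinate function `x`. -/
noncomputable def x {k : Type*} [Field k] (C : HyperellipticCurve k) : C.FunctionField :=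
  AdjoinRoot.of C.definingPolynomial (RatFunc.X : RatFunc k)

/-- An isomorphism of smooth projective curves over `k`, given by the `k`-isomorphism of function
fields that it induces: a birational map between smooth projective curves is an isomorphism.
An element of `Iso C C'` corresponds to a morphism `C → C'` whose pull-back is `φ.symm`. -/
abbrev Iso {k : Type*} [Field k] (C C' : HyperellipticCurve k) : Type _ :=
  C.FunctionField ≃ₐ[k] C'.FunctionField

/-- Two curves over `k` are isomorphic (over `k`). -/
def Isomorphic {k : Type*} [Field k] (C C' : HyperellipticCurve k) : Prop :=
  Nonempty (Iso C C')

/-- The branch points of `x` in the projective line: the roots of `f`, together with `∞` when `f`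
has degree `2g + 1`. -/
def branchPoints {k : Type*} [Field k] (C : HyperellipticCurve k) : Set (OnePoint k) :=
  {P | (∃ a : k, P = (a : OnePoint k) ∧ C.f.IsRoot a) ∨
    (P = OnePoint.infty ∧ C.f.natDegree = 2 * C.genus + 1)}

/-- A labelling `α₁, …, α_{2g+2}` of the roots of `f`, where one of them is `∞` if `f` has degree
`2g + 1`. -/
structure IsLabelling {k : Type*} [Field k] (C : HyperellipticCurve k)
    (α : Fin (2 * C.genus + 2) → OnePoint k) : Prop where
  injective : Function.Injective α
  range_eq : Set.range α = C.branchPoints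

/-- A point `P` of the curve, i.e. a valuation ring of its function field that contains the
constants, lies over the point `a` of the projective line: `x - a` (or `1 / x`, if `a = ∞`)
vanishes at `P`. Over an algebraically closed field, the only point over the root `αᵢ` of `f` is
the Weierstrass point `Wᵢ`. -/
def LiesOver {k : Type*} [Field k] (C : HyperellipticCurve k)
    (P : ValuationSubring C.FunctionField) (a : OnePoint k) : Prop :=
  (∀ c : k, algebraMap k C.FunctionField c ∈ P) ∧
    ((∃ b : k, a = (b : OnePoint k) ∧ C.x - algebraMap k C.FunctionField b ∈ P.nonunits) ∨
      (a = OnePoint.infty ∧ C.x⁻¹ ∈ P.nonunits))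

/-- The isomorphism `φ` takes the point of `C` over `αᵢ` to the point of `C'` over `βᵢ`,
for every `i`. -/
def Iso.MapsPointsOver {k : Type*} [Field k] {C C' : HyperellipticCurve k} (φ : Iso C C')
    {ι : Type*} (α β : ι → OnePoint k) : Prop :=
  ∀ i, ∃ P : ValuationSubring C.FunctionField,
    C.LiesOver P (α i) ∧
      C'.LiesOver (P.comap (φ.symm : C'.FunctionField →+* C.FunctionField)) (β i)

end HyperellipticCurve

/-- The factor `a - b`, which is replaced by `1` if `a` or `b` is `∞`. -/
def rootDiff {k : Type*} [Field k] (a b : OnePoint k) : k :=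
  match a, b with
  | some u, some v => u - v
  | _, _ => 1

/-- The symmetric ratios `p_{ijt} = ζ_t · (∏_{k ≠ i, j} (α_j - α_k) / (α_i - α_k)) ^ (1 / 2g)`,
for all `4g`-th roots of unity `ζ_t`. -/
def symmetricRatios {k : Type*} [Field k] (g : ℕ) {ι : Type*} [Fintype ι] [DecidableEq ι]
    (α : ι → OnePoint k) (i j : ι) : Set k :=
  {p | ∃ ζ r : k, ζ ^ (4 * g) = 1 ∧
    r ^ (2 * g) = ∏ m ∈ Finset.univ.filter (fun m => m ≠ i ∧ m ≠ j),
      rootDiff (α j) (α m) / rootDiff (α i) (α m) ∧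
    p = ζ * r}

/-- The symmetric root `ℓ_{ijm} = p (α_i - α_m) / (α_j - α_m)` that belongs to the symmetric
ratio `p`. -/
def symmetricRoot {k : Type*} [Field k] {ι : Type*} (α : ι → OnePoint k) (p : k) (i j m : ι) : k :=
  p * (rootDiff (α i) (α m) / rootDiff (α j) (α m))

/-- All the families `(ℓ_{ijtm})_{m ≠ i, j}` of symmetric roots, where `i` and `j` are fixed and
`t` varies: one family, with a common root of unity, for each symmetric ratio `p_{ijt}`. -/
def symmetricRootFamilies {k : Type*} [Field k] (g : ℕ) {ι : Type*} [Fintype ι] [DecidableEq ι]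
    (α : ι → OnePoint k) (i j : ι) : Set ({m : ι // m ≠ i ∧ m ≠ j} → k) :=
  (fun p m => symmetricRoot α p i j m.1) '' symmetricRatios g α i j

/-! The symmetric roots depend only on the cross ratios of the labelled branch points. Replacing a
factor with `∞` by `1` amounts to using determinants of homogeneous coordinates (`bracket`), as far
as the quotients occurring here are concerned. If `α` and `β` have the same cross ratios, then for
fixed `i`, `j` the quotients `(α_i - α_m) / (α_j - α_m)` for the two families differ by a factor `l`
independent of `m`. The product under the `2g`-th root then changes by a power `l ^ (2g)`, so `p ↦ p
/ l` matches the symmetric ratios and leaves the symmetric roots unchanged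
(`symmetricRootFamilies_eq`).

It remains to compare cross ratios. An isomorphism puts both presentations `y² = f(x)` and `v² =
f'(u)` into one field `F`. If `u ∈ k(x)`, then `k(u) = k(x)` by degrees, so `u` is a Möbius function
of `x` (`exists_mobius`); since `v` is `y` times an element of `k(x)`, the homogenized `f'` pulls
back to a square times `f`, and branch points go to branch points (`IsLabelling.exists_of_mobius`).

If `u ∉ k(x)`, then `x` and `u` satisfy an irreducible relation of degree at most 2 in each
variable. Its discriminant with respect to either variable has degree at most 4 and is a square
times `f`, respectively `f'`; as `deg f ≥ 3`, both genera are 1 and the discriminants are constant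
multiples of `f` and `f'` (`exists_biquadratic_relation`). The two discriminants of a biquadratic
polynomial share the invariants of binary quartics, which determine four distinct points up to order
and projective equivalence (`exists_perm_of_biquadraticDiscrim`). This replaces composing with a
translation of the genus one curve.

For (2), values of `x` and `u` at the given places show that the Möbius map induces the prescribed
bijection. The case `u ∉ k(x)` cannot occur: a Weierstrass point sent to a Weierstrass point would
give a common zero of both discriminants on the curve of bidegree (2, 2), a singular point, hence a
multiple root of `f`. -/

/-! ### Points of the projective line and cross ratios -/

section ProjectiveLine

variable {k : Type*} [Field k] {ι : Type*}

/-- The first homogeneous coordinate of a point of the projective line. -/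
def homX (P : OnePoint k) : k :=
  match P with
  | some u => u
  | _ => 1

/-- The second homogeneous coordinate of a point of the projective line. -/
def homY (P : OnePoint k) : k :=
  match P with
  | some _ => 1
  | _ => 0

/-- The determinant of the homogeneous coordinates of two points of the projective line. -/
def bracket (P Q : OnePoint k) : k := homX P * homY Q - homX Q * homY P

@[simp] theorem homX_coe (u : k) : homX (u : OnePoint k) = u := rfl
@[simp] theorem homX_infty : homX (OnePoint.infty : OnePoint k) = 1 := rfl
@[simp] theorem homY_coe (u : k) : homY (u : OnePoint k) = 1 := rfl
@[simp] theorem homY_infty : homY (OnePoint.infty : OnePoint k) = 0 := rfl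
@[simp] theorem rootDiff_coe_coe (u v : k) : rootDiff (u : OnePoint k) v = u - v := rfl
@[simp] theorem rootDiff_infty_left (P : OnePoint k) : rootDiff OnePoint.infty P = 1 := rfl
@[simp] theorem rootDiff_infty_right (P : OnePoint k) : rootDiff P OnePoint.infty = 1 := by
  induction P using OnePoint.rec <;> rfl

theorem bracket_swap (P Q : OnePoint k) : bracket P Q = -bracket Q P := by
  unfold bracket; ring

theorem bracket_ne_zero {P Q : OnePoint k} (h : P ≠ Q) : bracket P Q ≠ 0 := by
  induction P using OnePoint.rec <;> induction Q using OnePoint.rec <;>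
    simp_all [bracket, sub_eq_zero]

/-- The convention for `∞` agrees with determinants up to the sign `bracket P ∞ = -1`, which cancels
in the quotient. Distinctness matters: `rootDiff ∞ ∞` is `1`, while the determinant is `0`. -/
theorem rootDiff_div_rootDiff {P Q R : OnePoint k} (hP : P ≠ R) (hQ : Q ≠ R) :
    rootDiff P R / rootDiff Q R = bracket P R / bracket Q R := by
  induction P using OnePoint.rec <;> induction Q using OnePoint.rec <;>
    induction R using OnePoint.rec <;> simp_all [bracket]

theorem exists_onePoint_of_ne_zero {u v : k} (h : u ≠ 0 ∨ v ≠ 0) :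
    ∃ (P : OnePoint k) (s : k), s ≠ 0 ∧ u = s * homX P ∧ v = s * homY P := by
  by_cases hv : v = 0
  · exact ⟨OnePoint.infty, u, by simpa [hv] using h, by simp, by simp [hv]⟩
  · exact ⟨((u / v : k) : OnePoint k), v, hv, by simp [mul_div_cancel₀, hv], by simp⟩

/-- Two families of points of the projective line have the same cross ratios. -/
def SameCrossRatios (α β : ι → OnePoint k) : Prop :=
  ∀ i j m n, i ≠ j → i ≠ m → i ≠ n → j ≠ m → j ≠ n → m ≠ n →
    bracket (β i) (β m) * bracket (β j) (β n) * (bracket (α j) (α m) * bracket (α i) (α n)) =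
    bracket (α i) (α m) * bracket (α j) (α n) * (bracket (β j) (β m) * bracket (β i) (β n))

theorem SameCrossRatios.symm {α β : ι → OnePoint k} (h : SameCrossRatios α β) :
    SameCrossRatios β α :=
  fun i j m n h1 h2 h3 h4 h5 h6 => (h i j m n h1 h2 h3 h4 h5 h6).symm

theorem SameCrossRatios.comp {κ : Type*} {α β : ι → OnePoint k} (h : SameCrossRatios α β)
    {e : κ → ι} (he : Function.Injective e) :
    SameCrossRatios (fun i => α (e i)) (fun i => β (e i)) :=
  fun _ _ _ _ h1 h2 h3 h4 h5 h6 => h _ _ _ _ (he.ne h1) (he.ne h2) (he.ne h3) (he.ne h4)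
    (he.ne h5) (he.ne h6)

/-- Families that differ by a projective transformation have the same cross ratios. -/
theorem sameCrossRatios_of_scaling {α β : ι → OnePoint k} {d : k} {s : ι → k} (hs : ∀ i, s i ≠ 0)
    (h : ∀ i j, s i * s j * bracket (β i) (β j) = d * bracket (α i) (α j)) :
    SameCrossRatios α β := by
  intro i j m n _ _ _ _ _ _
  have hne : s i * s j * s m * s n ≠ 0 := by simp [hs]
  apply mul_left_cancel₀ hne
  calc _ = (s i * s m * bracket (β i) (β m)) * (s j * s n * bracket (β j) (β n)) *
        (bracket (α j) (α m) * bracket (α i) (α n)) := by ring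
    _ = (d * bracket (α j) (α m)) * (d * bracket (α i) (α n)) *
        (bracket (α i) (α m) * bracket (α j) (α n)) := by rw [h, h]; ring
    _ = _ := by rw [← h, ← h]; ring

/-- A linear map multiplies all determinants by its own determinant; the scalars `s i` come from
normalizing the image vectors. -/
theorem sameCrossRatios_of_linear {α β : ι → OnePoint k} {a b c d : k} {s : ι → k}
    (hs : ∀ i, s i ≠ 0)
    (h : ∀ i, a * homX (α i) + b * homY (α i) = s i * homX (β i) ∧
      c * homX (α i) + d * homY (α i) = s i * homY (β i)) :
    SameCrossRatios α β := by
  refine sameCrossRatios_of_scaling (d := a * d - b * c) hs fun i j => ?_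
  calc _ = (s i * homX (β i)) * (s j * homY (β j)) - (s j * homX (β j)) * (s i * homY (β i)) := by
        unfold bracket; ring
    _ = _ := by rw [← (h i).1, ← (h i).2, ← (h j).1, ← (h j).2]; unfold bracket; ring

theorem homX_map {k' : Type*} [Field k'] (f : k →+* k') (P : OnePoint k) :
    homX (OnePoint.map f P) = f (homX P) := by
  induction P using OnePoint.rec <;> simp

theorem homY_map {k' : Type*} [Field k'] (f : k →+* k') (P : OnePoint k) :
    homY (OnePoint.map f P) = f (homY P) := by
  induction P using OnePoint.rec <;> simp

theorem bracket_map {k' : Type*} [Field k'] (f : k →+* k') (P Q : OnePoint k) :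
    bracket (OnePoint.map f P) (OnePoint.map f Q) = f (bracket P Q) := by
  simp [bracket, homX_map, homY_map]

theorem SameCrossRatios.of_map {k' : Type*} [Field k'] (f : k →+* k') {α β : ι → OnePoint k}
    (h : SameCrossRatios (fun i => OnePoint.map f (α i)) (fun i => OnePoint.map f (β i))) :
    SameCrossRatios α β := by
  intro i j m n h1 h2 h3 h4 h5 h6
  have := h i j m n h1 h2 h3 h4 h5 h6
  simp only [bracket_map, ← map_mul] at this
  exact f.injective this

end ProjectiveLine

/-! ### Symmetric roots and cross ratios -/

section SymmetricRoots

variable {k : Type*} [Field k] {ι : Type*} [Fintype ι] [DecidableEq ι]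

theorem rootDiff_ne_zero {P Q : OnePoint k} (h : P ≠ Q) : rootDiff P Q ≠ 0 := by
  induction P using OnePoint.rec <;> induction Q using OnePoint.rec <;>
    simp_all [sub_eq_zero]

/-- The roots of unity have order dividing `4g` rather than `2g`, so the symmetric ratios are
exactly the `4g`-th roots of the square of the product, in every characteristic. This frees the set
from the choice of `r`. -/
theorem mem_symmetricRatios_iff [IsAlgClosed k] {g : ℕ} (hg : 1 ≤ g) {α : ι → OnePoint k}
    (hα : Function.Injective α) {i j : ι} {p : k} :
    p ∈ symmetricRatios g α i j ↔
      p ^ (4 * g) = (∏ m ∈ Finset.univ.filter (fun m => m ≠ i ∧ m ≠ j),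
        rootDiff (α j) (α m) / rootDiff (α i) (α m)) ^ 2 := by
  have hS : (∏ m ∈ Finset.univ.filter (fun m => m ≠ i ∧ m ≠ j),
        rootDiff (α j) (α m) / rootDiff (α i) (α m)) ≠ 0 := by
    refine Finset.prod_ne_zero_iff.mpr fun m hm => ?_
    simp only [Finset.mem_filter, Finset.mem_univ, true_and] at hm
    exact div_ne_zero (rootDiff_ne_zero (hα.ne hm.2.symm)) (rootDiff_ne_zero (hα.ne hm.1.symm))
  unfold symmetricRatios
  generalize (∏ m ∈ Finset.univ.filter (fun m => m ≠ i ∧ m ≠ j),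
        rootDiff (α j) (α m) / rootDiff (α i) (α m)) = S at hS ⊢
  have h4 : 4 * g = 2 * g * 2 := by ring
  constructor
  · rintro ⟨ζ, r, hζ, hr, rfl⟩
    rw [mul_pow, hζ, one_mul, h4, pow_mul, hr]
  · intro hp
    obtain ⟨r, hr⟩ := IsAlgClosed.exists_pow_nat_eq S (n := 2 * g) (by omega)
    have hr0 : r ≠ 0 := by
      rintro rfl
      exact hS (by rw [← hr, zero_pow (by omega)])
    refine ⟨p / r, r, ?_, hr, by field_simp⟩
    rw [div_pow, hp, h4, pow_mul r, hr, div_self (pow_ne_zero _ hS)]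

theorem symmetricRootFamilies_subset [IsAlgClosed k] {g : ℕ} (hg : 1 ≤ g)
    (hι : Fintype.card ι = 2 * g + 2) {α β : ι → OnePoint k}
    (hα : Function.Injective α) (hβ : Function.Injective β) (h : SameCrossRatios α β)
    {i j : ι} (hij : i ≠ j) :
    symmetricRootFamilies g α i j ⊆ symmetricRootFamilies g β i j := by
  set T := Finset.univ.filter (fun m : ι => m ≠ i ∧ m ≠ j) with hT
  have hcard : T.card = 2 * g := by
    have : T = (Finset.univ.erase i).erase j := by
      ext m; simp [hT, and_comm]
    rw [this, Finset.card_erase_of_mem (by simp [hij.symm]), Finset.card_erase_of_mem (by simp),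
      Finset.card_univ, hι]
    omega
  have hmem : ∀ m, m ∈ T ↔ m ≠ i ∧ m ≠ j := by simp [hT]
  obtain ⟨n, hn⟩ : T.Nonempty := Finset.card_pos.mp (by omega)
  obtain ⟨hni, hnj⟩ := (hmem n).mp hn
  have hb : ∀ {γ : ι → OnePoint k}, Function.Injective γ → ∀ {a b}, a ≠ b →
    bracket (γ a) (γ b) ≠ 0 := fun hγ a b hab => bracket_ne_zero (hγ.ne hab)
  -- The constant relating the two families is read off at one index `n`; equality of cross ratios
  -- makes it the same at every other index.
  set l : k := (rootDiff (β i) (β n) / rootDiff (β j) (β n)) /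
    (rootDiff (α i) (α n) / rootDiff (α j) (α n)) with hl
  have hl0 : l ≠ 0 := by
    refine div_ne_zero (div_ne_zero ?_ ?_) (div_ne_zero ?_ ?_) <;> apply rootDiff_ne_zero
    exacts [hβ.ne hni.symm, hβ.ne hnj.symm, hα.ne hni.symm, hα.ne hnj.symm]
  have key : ∀ m ∈ T, rootDiff (β i) (β m) / rootDiff (β j) (β m) =
      l * (rootDiff (α i) (α m) / rootDiff (α j) (α m)) := by
    intro m hm
    obtain ⟨hmi, hmj⟩ := (hmem m).mp hm
    rw [hl, rootDiff_div_rootDiff (hβ.ne hmi.symm) (hβ.ne hmj.symm),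
      rootDiff_div_rootDiff (hβ.ne hni.symm) (hβ.ne hnj.symm),
      rootDiff_div_rootDiff (hα.ne hmi.symm) (hα.ne hmj.symm),
      rootDiff_div_rootDiff (hα.ne hni.symm) (hα.ne hnj.symm)]
    have e1 := hb hβ hmi.symm
    have e2 := hb hβ hmj.symm
    have e3 := hb hβ hni.symm
    have e4 := hb hβ hnj.symm
    have f1 := hb hα hmi.symm
    have f2 := hb hα hmj.symm
    have f3 := hb hα hni.symm
    have f4 := hb hα hnj.symm
    by_cases hmn : m = n
    · subst hmn
      field_simp
    · have := h i j m n hij hmi.symm hni.symm hmj.symm hnj.symm hmn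
      field_simp
      linear_combination this
  have hprod : (∏ m ∈ T, rootDiff (α j) (α m) / rootDiff (α i) (α m)) =
      l ^ (2 * g) * ∏ m ∈ T, rootDiff (β j) (β m) / rootDiff (β i) (β m) := by
    rw [← hcard, ← Finset.prod_const, ← Finset.prod_mul_distrib]
    refine Finset.prod_congr rfl fun m hm => ?_
    rw [← inv_div (rootDiff (β i) (β m)), key m hm, mul_inv, inv_div (rootDiff (α i) (α m)),
      ← mul_assoc, mul_inv_cancel₀ hl0, one_mul]
  rintro _ ⟨p, hp, rfl⟩
  rw [mem_symmetricRatios_iff hg hα, ← hT, hprod] at hp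
  -- Dividing by `l` compensates the factor `l` in each quotient, and `|T| = 2g` makes it compatible
  -- with the product.
  refine ⟨p / l, ?_, ?_⟩
  · rw [mem_symmetricRatios_iff hg hβ, ← hT, div_pow, hp]
    have : l ^ (4 * g) ≠ 0 := pow_ne_zero _ hl0
    field_simp
    ring
  · funext m
    simp only [symmetricRoot]
    rw [key m.1 ((hmem _).mpr m.2)]
    field_simp

theorem symmetricRootFamilies_eq [IsAlgClosed k] {g : ℕ} (hg : 1 ≤ g)
    (hι : Fintype.card ι = 2 * g + 2) {α β : ι → OnePoint k}
    (hα : Function.Injective α) (hβ : Function.Injective β) (h : SameCrossRatios α β)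
    {i j : ι} (hij : i ≠ j) :
    symmetricRootFamilies g α i j = symmetricRootFamilies g β i j :=
  (symmetricRootFamilies_subset hg hι hα hβ h hij).antisymm
    (symmetricRootFamilies_subset hg hι hβ hα h.symm hij)

end SymmetricRoots

/-! ### Function fields of hyperelliptic curves -/

open IntermediateField in
/-- The field `F` is the function field `k(x, y)`, `y ^ 2 = f(x)`, a quadratic extension of the
rational function field `k(x)`. -/
structure IsQuadraticOver {k F : Type*} [Field k] [Field F] [Algebra k F] (f : k[X]) (x y : F) :
    Prop where
  transcendental : Transcendental k x
  sq : y ^ 2 = aeval x f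
  notMem : y ∉ k⟮x⟯
  span : ∀ z : F, ∃ a ∈ k⟮x⟯, ∃ b ∈ k⟮x⟯, z = a + b * y

/-! ### Algebraic relations between two elements of a function field -/

section Relations

variable {k F : Type*} [Field k] [Field F] [Algebra k F]

open IntermediateField

theorem aeval_mem_adjoin (x : F) (p : k[X]) : aeval x p ∈ k⟮x⟯ :=
  algebra_adjoin_le_adjoin k _ (aeval_mem_adjoin_singleton k x)

theorem eq_zero_of_aeval_eq_zero {x : F} (hx : Transcendental k x) {p : k[X]}
    (h : aeval x p = 0) : p = 0 := by
  by_contra hp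
  exact hx ⟨p, hp, h⟩

theorem exists_aeval_mul_eq_of_mem_adjoin {x z : F} (h : z ∈ k⟮x⟯) :
    ∃ p r : k[X], aeval x r ≠ 0 ∧ aeval x r * z = aeval x p := by
  obtain ⟨p, r, rfl⟩ := (mem_adjoin_simple_iff k z).mp h
  by_cases hr : aeval x r = 0
  · exact ⟨0, 1, by simp, by simp [hr]⟩
  · exact ⟨p, r, hr, by field_simp⟩

theorem exists_irreducible_aevalAeval_eq_zero {x u : F} {H : k[X][X]} (hH : H ≠ 0)
    (h : aevalAeval x u H = 0) : ∃ N, Irreducible N ∧ N ∣ H ∧ aevalAeval x u N = 0 := by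
  have hprod := UniqueFactorizationMonoid.factors_prod hH
  obtain ⟨w, hw⟩ := hprod
  have h0 : aevalAeval x u (UniqueFactorizationMonoid.factors H).prod = 0 := by
    rw [← hw, map_mul] at h
    exact (mul_eq_zero.mp h).resolve_right (w.isUnit.map (aevalAeval x u)).ne_zero
  rw [map_multiset_prod, Multiset.prod_eq_zero_iff, Multiset.mem_map] at h0
  obtain ⟨N, hN, hN0⟩ := h0
  exact ⟨N, UniqueFactorizationMonoid.irreducible_of_factor N hN,
    UniqueFactorizationMonoid.dvd_of_mem_factors hN, hN0⟩

theorem natDegree_ne_zero_of_aevalAeval_eq_zero {x u : F} (hx : Transcendental k x) {N : k[X][X]}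
    (hN : N ≠ 0) (h : aevalAeval x u N = 0) : N.natDegree ≠ 0 := by
  intro h0
  rw [eq_C_of_natDegree_eq_zero h0, aevalAeval_C] at h
  rw [eq_C_of_natDegree_eq_zero h0, eq_zero_of_aeval_eq_zero hx h, C_0] at hN
  exact hN rfl

/-- An irreducible relation between `x` and `u` divides every other one. -/
theorem dvd_of_aevalAeval_eq_zero {x u : F} (hx : Transcendental k x) {N G : k[X][X]}
    (hN : Irreducible N) (hNu : aevalAeval x u N = 0)
    (hGu : aevalAeval x u G = 0) : N ∣ G := by
  have hNp := hN.isPrimitive (natDegree_ne_zero_of_aevalAeval_eq_zero hx hN.ne_zero hNu)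
  have hNi := (hNp.irreducible_iff_irreducible_map_fraction_map (K := RatFunc k)).mp hN
  rw [hNp.dvd_iff_fraction_map_dvd_fraction_map (RatFunc k)]
  by_contra hnd
  obtain ⟨a, b, hab⟩ := (hNi.coprime_iff_not_dvd).mpr hnd
  have hinj : Function.Injective (aeval x : k[X] →ₐ[k] F) :=
    transcendental_iff_injective.mp hx
  let j : RatFunc k →+* F := IsFractionRing.lift (A := k[X])
    (g := (aeval x : k[X] →ₐ[k] F).toRingHom) hinj
  have hj : j.comp (algebraMap k[X] (RatFunc k)) = (aeval x : k[X] →ₐ[k] F).toRingHom := by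
    exact RingHom.ext fun p => IsFractionRing.lift_algebraMap hinj p
  have hev : ∀ P : k[X][X], eval₂ j u (P.map (algebraMap k[X] (RatFunc k))) = aevalAeval x u P := by
    intro P
    rw [eval₂_map, hj]
    induction P using Polynomial.induction_on' with
    | add p q hp hq => rw [eval₂_add, hp, hq, map_add]
    | monomial n a => simp
  have := congrArg (eval₂ j u) hab
  rw [eval₂_add, eval₂_mul, eval₂_mul, hev, hev, hNu, hGu] at this
  simp at this

theorem coeff_coeff_swap (N : k[X][X]) (i j : ℕ) :
    ((Bivariate.swap N).coeff i).coeff j = (N.coeff j).coeff i := by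
  induction N using Polynomial.induction_on' with
  | add p q hp hq => simp [hp, hq]
  | monomial n a =>
    induction a using Polynomial.induction_on' with
    | add p q hp hq => simp only [map_add, coeff_add, hp, hq]
    | monomial m r =>
      rw [Bivariate.swap_monomial_monomial]
      simp only [coeff_monomial]
      split_ifs <;> simp [coeff_monomial, *]

/-- If there are relations between `x` and `u` of degree `≤ m` in `u` and of degree `≤ n` in `x`,
then there is a relation that satisfies both bounds. -/
theorem exists_relation {x u : F} (hx : Transcendental k x)
    {m n : ℕ} {H G : k[X][X]} (hH : H ≠ 0) (hHm : H.natDegree ≤ m) (hHu : aevalAeval x u H = 0)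
    (hG : G ≠ 0) (hGn : G.natDegree ≤ n) (hGu : aevalAeval u x G = 0) :
    ∃ N : k[X][X], N ≠ 0 ∧ N.natDegree ≤ m ∧ (∀ i, (N.coeff i).natDegree ≤ n) ∧
      aevalAeval x u N = 0 := by
  obtain ⟨N, hNi, hNH, hNu⟩ := exists_irreducible_aevalAeval_eq_zero hH hHu
  obtain ⟨G', hGi, hGG, hGu'⟩ := exists_irreducible_aevalAeval_eq_zero hG hGu
  have hsw : Irreducible (Bivariate.swap G') := (MulEquiv.irreducible_iff _).mpr hGi
  -- The irreducible relation found with small degree in `u` divides the one found with small degree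
  -- in `x`, so it inherits both bounds.
  have hd : N ∣ Bivariate.swap G' :=
    dvd_of_aevalAeval_eq_zero hx hNi hNu (by rw [Bivariate.aevalAeval_swap, hGu'])
  have hd' : Bivariate.swap N ∣ G' := by
    have := map_dvd (Bivariate.swap (R := k)) hd
    rwa [Bivariate.swap_swap_apply] at this
  have hdeg : (Bivariate.swap N).natDegree ≤ n :=
    ((natDegree_le_of_dvd hd' hGi.ne_zero).trans (natDegree_le_of_dvd hGG hG)).trans hGn
  refine ⟨N, hNi.ne_zero, (natDegree_le_of_dvd hNH hH).trans hHm, fun i => ?_, hNu⟩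
  refine natDegree_le_iff_coeff_eq_zero.mpr fun l hl => ?_
  rw [← coeff_coeff_swap, coeff_eq_zero_of_natDegree_lt (hdeg.trans_lt hl), coeff_zero]

end Relations

/-! ### Quadratic extensions of a rational function field -/

section Quadratic

variable {k F : Type*} [Field k] [Field F] [Algebra k F]

open IntermediateField

/-- With `q / r` in lowest terms the square of the denominator divides the squarefree `f`, so the
denominator is a unit. -/
theorem exists_eq_sq_mul_of_sq_mul_eq {f D q r : k[X]} (hf : Squarefree f) (hr : r ≠ 0)
    (h : r ^ 2 * D = q ^ 2 * f) : ∃ s, D = s ^ 2 * f := by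
  obtain ⟨q', r', c, hc, rfl, rfl⟩ := UniqueFactorizationMonoid.exists_reduced_factors' q r hr
  have hc0 : c ≠ 0 := left_ne_zero_of_mul hr
  have h' : r' ^ 2 * D = q' ^ 2 * f := by
    apply mul_left_cancel₀ (pow_ne_zero 2 hc0)
    linear_combination h
  have hcop : IsCoprime (r' ^ 2) (q' ^ 2) := hc.symm.isCoprime.pow
  have hdvd : r' * r' ∣ f := by
    rw [← pow_two]
    exact hcop.dvd_of_dvd_mul_left ⟨D, h'.symm⟩
  obtain ⟨w, hw⟩ := (hf r' hdvd).exists_left_inv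
  refine ⟨w * q', ?_⟩
  linear_combination w ^ 2 * h' - (w * r' + 1) * D * hw

theorem exists_eq_sq_mul_of_aeval {f D : k[X]} (hf : Squarefree f) {x b : F}
    (hx : Transcendental k x) (hb : b ∈ k⟮x⟯) (h : aeval x D = b ^ 2 * aeval x f) :
    ∃ s, D = s ^ 2 * f := by
  obtain ⟨q, r, hr, hrq⟩ := exists_aeval_mul_eq_of_mem_adjoin hb
  refine exists_eq_sq_mul_of_sq_mul_eq (r := r) (q := q) hf (by rintro rfl; simp at hr) ?_
  refine transcendental_iff_injective.mp hx ?_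
  simp only [map_mul, map_pow, ← hrq, h]
  ring

theorem exists_linear_relation {x z : F} (h : z ∈ k⟮x⟯) :
    ∃ H : k[X][X], H ≠ 0 ∧ H.natDegree ≤ 1 ∧ aevalAeval x z H = 0 := by
  obtain ⟨p, r, hr, hrp⟩ := exists_aeval_mul_eq_of_mem_adjoin h
  refine ⟨C r * X - C p, ?_, by compute_degree, by simp [hrp]⟩
  intro h0
  have : (C r * X - C p : k[X][X]).coeff 1 = r := by simp [coeff_C]
  rw [h0, coeff_zero] at this
  simp [← this] at hr

namespace IsQuadraticOver

variable {f : k[X]} {x y : F}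

theorem exists_quadratic_relation (h : IsQuadraticOver f x y) (z : F) :
    ∃ H : k[X][X], H ≠ 0 ∧ H.natDegree ≤ 2 ∧ aevalAeval x z H = 0 := by
  obtain ⟨a, ha, b, hb, rfl⟩ := h.span z
  obtain ⟨p, r, hr, hrp⟩ := exists_aeval_mul_eq_of_mem_adjoin ha
  obtain ⟨q, t, ht, htq⟩ := exists_aeval_mul_eq_of_mem_adjoin hb
  -- This is `(z - a)² = b² f(x)` with the denominators `r` of `a` and `t` of `b` cleared.
  refine ⟨(C (r * t) * X - C (p * t)) ^ 2 - C ((q * r) ^ 2 * f), ?_, by compute_degree, ?_⟩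
  · intro h0
    have h1 : ((C (r * t) * X - C (p * t)) ^ 2 - C ((q * r) ^ 2 * f) : k[X][X]).coeff 2 =
        (r * t) ^ 2 := by
      have : ((C (r * t) * X - C (p * t)) ^ 2 - C ((q * r) ^ 2 * f) : k[X][X]) =
        C ((r * t) ^ 2) * X ^ 2 + C (-2 * (r * t) * (p * t)) * X +
          C ((p * t) ^ 2 - (q * r) ^ 2 * f) := by
        simp only [C_mul, C_pow, C_sub, C_neg, map_ofNat]; ring
      rw [this]
      simp only [coeff_add, coeff_C_mul, coeff_X_pow, coeff_X, coeff_C]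
      norm_num
    rw [h0, coeff_zero] at h1
    have := congrArg (aeval x) h1
    simp only [map_zero, map_pow, map_mul] at this
    exact pow_ne_zero 2 (mul_ne_zero hr ht) this.symm
  · simp only [map_sub, map_mul, map_pow, aevalAeval_C, aevalAeval_Y, ← hrp, ← htq, ← h.sq]
    ring

/-- The coefficient of `y` in `(a + b y)²` is `2ab`, which must vanish. -/
theorem mem_or_eq_mul_of_sq_mem (h2 : (2 : k) ≠ 0) (h : IsQuadraticOver f x y) {w : F}
    (hw : w ^ 2 ∈ k⟮x⟯) : w ∈ k⟮x⟯ ∨ ∃ b ∈ k⟮x⟯, w = b * y := by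
  obtain ⟨a, ha, b, hb, rfl⟩ := h.span w
  have h2F : (2 : F) ≠ 0 := by
    have := (map_ne_zero (algebraMap k F)).mpr h2
    rwa [map_ofNat] at this
  have h2m : (2 : F) ∈ k⟮x⟯ := by
    have := IntermediateField.algebraMap_mem k⟮x⟯ (2 : k)
    rwa [map_ofNat] at this
  by_cases hab : 2 * a * b = 0
  · rcases mul_eq_zero.mp hab with h0 | h0
    · rw [mul_eq_zero, or_iff_right h2F] at h0
      exact Or.inr ⟨b, hb, by simp [h0]⟩
    · exact Or.inl (by simpa [h0] using ha)
  · refine absurd ?_ h.notMem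
    have hy : y = ((a + b * y) ^ 2 - a ^ 2 - b ^ 2 * aeval x f) / (2 * a * b) := by
      rw [eq_div_iff hab, ← h.sq]; ring
    rw [hy]
    exact div_mem (sub_mem (sub_mem hw (pow_mem ha 2))
      (mul_mem (pow_mem hb 2) (aeval_mem_adjoin x f))) (mul_mem (mul_mem h2m ha) hb)

/-- `F` has degree 2 over both `k(u)` and `k(x)`, so an inclusion between them is an equality. -/
theorem mem_adjoin_of_mem_adjoin {f' : k[X]} {u v : F} (h : IsQuadraticOver f x y)
    (h' : IsQuadraticOver f' u v) (hu : u ∈ k⟮x⟯) : x ∈ k⟮u⟯ := by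
  have hle : k⟮u⟯ ≤ k⟮x⟯ := adjoin_simple_le_iff.mpr hu
  obtain ⟨a, ha, b, hb, hx⟩ := h'.span x
  by_cases hb0 : b = 0
  · rw [hx, hb0, zero_mul, add_zero]; exact ha
  · exfalso
    have hv : v ∈ k⟮x⟯ := by
      have : v = (x - a) / b := by rw [hx]; field_simp; ring
      rw [this]
      exact div_mem (sub_mem (mem_adjoin_simple_self k x) (hle ha)) (hle hb)
    obtain ⟨c, hc, d, hd, hy⟩ := h'.span y
    apply h.notMem
    rw [hy]
    exact add_mem (hle hc) (mul_mem (hle hd) hv)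

/-- A second generator of the rational subfield is a fractional linear function of the first. -/
theorem exists_mobius {f' : k[X]} {u v : F} (h : IsQuadraticOver f x y)
    (h' : IsQuadraticOver f' u v) (hu : u ∈ k⟮x⟯) :
    ∃ a b c d : k, a * d - b * c ≠ 0 ∧
      u * (algebraMap k F c * x + algebraMap k F d) = algebraMap k F a * x + algebraMap k F b := by
  obtain ⟨H, hH, hH1, hHu⟩ := exists_linear_relation hu
  obtain ⟨G, hG, hG1, hGu⟩ := exists_linear_relation (h.mem_adjoin_of_mem_adjoin h' hu)
  obtain ⟨N, hN, hN1, hN2, hNu⟩ := exists_relation h.transcendental hH hH1 hHu hG hG1 hGu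
  have hNe : N = C (C ((N.coeff 1).coeff 1) * X + C ((N.coeff 1).coeff 0)) * X +
      C (C ((N.coeff 0).coeff 1) * X + C ((N.coeff 0).coeff 0)) := by
    conv_lhs => rw [eq_X_add_C_of_natDegree_le_one hN1]
    rw [← eq_X_add_C_of_natDegree_le_one (hN2 1), ← eq_X_add_C_of_natDegree_le_one (hN2 0)]
  generalize (N.coeff 1).coeff 1 = c at hNe
  generalize (N.coeff 1).coeff 0 = d at hNe
  generalize (N.coeff 0).coeff 1 = a at hNe
  generalize (N.coeff 0).coeff 0 = b at hNe
  have hrel : u * (algebraMap k F c * x + algebraMap k F d) +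
      (algebraMap k F a * x + algebraMap k F b) = 0 := by
    rw [hNe] at hNu
    simp only [map_add, map_mul, aevalAeval_C, aevalAeval_Y, aeval_C, aeval_X] at hNu
    linear_combination hNu
  have hlin : ∀ {t : F}, Transcendental k t → ∀ {a b : k},
      algebraMap k F a * t + algebraMap k F b = 0 → a = 0 ∧ b = 0 := by
    intro t ht a b h0
    have := eq_zero_of_aeval_eq_zero ht (p := C a * X + C b) (by simpa using h0)
    exact ⟨by simpa using congrArg (coeff · 1) this, by simpa using congrArg (coeff · 0) this⟩
  refine ⟨-a, -b, c, d, ?_, ?_⟩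
  · intro hdet
    -- When the determinant vanishes, `c` times the relation splits into a factor in `u` and a
    -- factor in `x`; transcendence then kills the coefficients.
    have key1 : (algebraMap k F c * u + algebraMap k F a) *
        (algebraMap k F c * x + algebraMap k F d) = 0 := by
      have : algebraMap k F a * algebraMap k F d = algebraMap k F b * algebraMap k F c := by
        rw [← map_mul, ← map_mul]; congr 1; linear_combination -hdet
      linear_combination algebraMap k F c * hrel + this
    have : c = 0 ∧ d = 0 ∨ c = 0 ∧ a = 0 := by
      rcases mul_eq_zero.mp key1 with h0 | h0
      · exact Or.inr (hlin h'.transcendental h0)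
      · exact Or.inl (hlin h.transcendental h0)
    apply hN
    rcases this with ⟨rfl, rfl⟩ | ⟨rfl, rfl⟩
    · obtain ⟨rfl, rfl⟩ := hlin h.transcendental (by simpa using hrel)
      simp [hNe]
    · obtain ⟨rfl, rfl⟩ := hlin h'.transcendental (a := d) (b := b) (by simpa [mul_comm] using hrel)
      simp [hNe]
  · simp only [map_neg]
    linear_combination hrel

end IsQuadraticOver

end Quadratic

/-! ### The function field of a curve as a quadratic extension -/

section FunctionFieldOfCurve

open IntermediateField

/-- Applied to the inverse of an isomorphism of curves, this places both pairs of coordinate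
functions in one field. -/
theorem IsQuadraticOver.map {k F F' : Type*} [Field k] [Field F] [Algebra k F] [Field F']
    [Algebra k F'] {f : k[X]} {x y : F} (h : IsQuadraticOver f x y) (φ : F ≃ₐ[k] F') :
    IsQuadraticOver f (φ x) (φ y) := by
  have hmap : k⟮x⟯.map (φ : F →ₐ[k] F') = k⟮φ x⟯ := by
    rw [adjoin_map, Set.image_singleton]; rfl
  have hmem : ∀ {z}, z ∈ k⟮x⟯ → φ z ∈ k⟮φ x⟯ := fun {z} hz => hmap ▸ ⟨z, hz, rfl⟩
  refine ⟨?_, ?_, ?_, fun z => ?_⟩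
  · exact fun hx => h.transcendental ((isAlgebraic_algHom_iff (φ : F →ₐ[k] F') φ.injective).mp hx)
  · rw [← map_pow, h.sq]
    exact (aeval_algHom_apply (φ : F →ₐ[k] F') x f).symm
  · intro hy
    rw [← hmap] at hy
    obtain ⟨z, hz, hzy⟩ := hy
    exact h.notMem (φ.injective hzy ▸ hz)
  · obtain ⟨a, ha, b, hb, hz⟩ := h.span (φ.symm z)
    refine ⟨φ a, hmem ha, φ b, hmem hb, ?_⟩
    rw [← map_mul, ← map_add, ← hz, φ.apply_symm_apply]

namespace HyperellipticCurve

variable {k : Type*} [Field k] (C : HyperellipticCurve k)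

/-- The coordinate function `y`. -/
noncomputable def y : C.FunctionField := AdjoinRoot.root C.definingPolynomial

theorem mem_adjoin_x_iff (z : C.FunctionField) :
    z ∈ k⟮C.x⟯ ↔ ∃ q : RatFunc k, AdjoinRoot.of C.definingPolynomial q = z := by
  have h : k⟮C.x⟯ = (AdjoinRoot.ofAlgHom k C.definingPolynomial).fieldRange := by
    rw [AlgHom.fieldRange_eq_map, ← RatFunc.adjoin_X, adjoin_map, Set.image_singleton]
    rfl
  rw [h]
  rfl

theorem monic_definingPolynomial : C.definingPolynomial.Monic := by
  unfold definingPolynomial; monicity!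

theorem natDegree_definingPolynomial : C.definingPolynomial.natDegree = 2 := by
  unfold definingPolynomial; compute_degree!

theorem aeval_x (p : k[X]) :
    aeval C.x p = AdjoinRoot.of C.definingPolynomial (algebraMap k[X] (RatFunc k) p) := by
  have h := aeval_algHom_apply (AdjoinRoot.ofAlgHom k C.definingPolynomial) RatFunc.X p
  have h' : aeval (RatFunc.X : RatFunc k) p = algebraMap k[X] (RatFunc k) p := by
    rw [← RatFunc.algebraMap_X, aeval_algebraMap_apply, aeval_X_left_apply]
  rw [h'] at h
  exact h

theorem isQuadraticOver : IsQuadraticOver C.f C.x C.y := by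
  have hmonic := C.monic_definingPolynomial
  have hdeg := C.natDegree_definingPolynomial
  refine ⟨?_, ?_, ?_, fun z => ?_⟩
  · exact fun hx => RatFunc.transcendental_X (K := k) ((isAlgebraic_algHom_iff
      (AdjoinRoot.ofAlgHom k C.definingPolynomial) (RingHom.injective _)).mp hx)
  · rw [aeval_x]
    have := AdjoinRoot.eval₂_root C.definingPolynomial
    have h0 : eval₂ (AdjoinRoot.of C.definingPolynomial) (AdjoinRoot.root C.definingPolynomial)
      (X ^ 2 - Polynomial.C (algebraMap k[X] (RatFunc k) C.f)) = 0 := this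
    rwa [eval₂_sub, eval₂_X_pow, eval₂_C, sub_eq_zero] at h0
  · rw [mem_adjoin_x_iff]
    rintro ⟨q, hq⟩
    refine AdjoinRoot.mk_ne_zero_of_natDegree_lt hmonic (X_sub_C_ne_zero q) ?_ ?_
    · rw [hdeg, natDegree_X_sub_C]; norm_num
    · rw [map_sub, AdjoinRoot.mk_X, AdjoinRoot.mk_C]
      exact sub_eq_zero.mpr hq.symm
  · obtain ⟨p, rfl⟩ := AdjoinRoot.mk_surjective z
    have h1 : AdjoinRoot.mk C.definingPolynomial p =
        AdjoinRoot.mk C.definingPolynomial (p %ₘ C.definingPolynomial) := by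
      rw [AdjoinRoot.mk_eq_mk]
      exact ⟨p /ₘ C.definingPolynomial, by
        linear_combination -modByMonic_add_div p C.definingPolynomial⟩
    have h2 : (p %ₘ C.definingPolynomial).natDegree ≤ 1 := by
      have := natDegree_modByMonic_lt p hmonic (fun h => by
        rw [h, natDegree_one] at hdeg; exact absurd hdeg (by norm_num))
      omega
    refine ⟨_, (C.mem_adjoin_x_iff _).mpr ⟨(p %ₘ C.definingPolynomial).coeff 0, rfl⟩, _,
      (C.mem_adjoin_x_iff _).mpr ⟨(p %ₘ C.definingPolynomial).coeff 1, rfl⟩, ?_⟩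
    rw [h1]
    conv_lhs => rw [eq_X_add_C_of_natDegree_le_one h2]
    rw [map_add, map_mul, AdjoinRoot.mk_X, AdjoinRoot.mk_C, AdjoinRoot.mk_C, add_comm]
    rfl

end HyperellipticCurve

end FunctionFieldOfCurve

/-! ### Branch points and homogenizations -/

section HomForm

variable {k : Type*} [Field k]

/-- The value at `(a, b)` of the homogenization of degree `n` of the polynomial `f`. -/
def homForm {A : Type*} [CommRing A] [Algebra k A] (n : ℕ) (f : k[X]) (a b : A) : A :=
  ∑ i ∈ Finset.range (n + 1), algebraMap k A (f.coeff i) * a ^ i * b ^ (n - i)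

variable {A B : Type*} [CommRing A] [Algebra k A] [CommRing B] [Algebra k B]

theorem map_homForm (φ : A →ₐ[k] B) (n : ℕ) (f : k[X]) (a b : A) :
    φ (homForm n f a b) = homForm n f (φ a) (φ b) := by
  simp [homForm]

theorem homForm_mul (n : ℕ) (f : k[X]) (s a b : A) :
    homForm n f (s * a) (s * b) = s ^ n * homForm n f a b := by
  simp only [homForm, Finset.mul_sum]
  refine Finset.sum_congr rfl fun i hi => ?_
  have : n = i + (n - i) := by have := Finset.mem_range.mp hi; omega
  conv_rhs => rw [this, pow_add]
  rw [Nat.add_sub_cancel_left]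
  ring

theorem homForm_one_right {n : ℕ} {f : k[X]} (hf : f.natDegree ≤ n) (a : A) :
    homForm n f a 1 = aeval a f := by
  rw [aeval_eq_sum_range' (Nat.lt_succ_of_le hf)]
  simp [homForm, Algebra.smul_def]

theorem homForm_zero_right (n : ℕ) (f : k[X]) (a : A) :
    homForm n f a 0 = algebraMap k A (f.coeff n) * a ^ n := by
  rw [homForm, Finset.sum_eq_single n]
  · simp
  · intro i hi hin
    rw [zero_pow, mul_zero]
    have := Finset.mem_range.mp hi; omega
  · simp

theorem homForm_mul_right {n : ℕ} {f : k[X]} (hf : f.natDegree ≤ n) (q u : A) :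
    homForm n f (q * u) q = q ^ n * aeval u f := by
  have := homForm_mul n f q u 1
  rwa [mul_one, homForm_one_right hf] at this

/-- Homogenizing in degree `2g + 2` makes `∞` a zero exactly when the degree of `f` drops to `2g +
1`. -/
theorem HyperellipticCurve.mem_branchPoints_iff (C : HyperellipticCurve k) (P : OnePoint k) :
    P ∈ C.branchPoints ↔ homForm (2 * C.genus + 2) C.f (homX P) (homY P) = 0 := by
  have hd := C.natDegree_f
  induction P using OnePoint.rec with
  | infty =>
    have : C.f.coeff (2 * C.genus + 2) = 0 ↔ C.f.natDegree = 2 * C.genus + 1 := by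
      constructor
      · intro h
        refine hd.resolve_right fun h' => ?_
        rw [← h', coeff_natDegree, leadingCoeff_eq_zero] at h
        rw [h, natDegree_zero] at h'
        omega
      · intro h
        exact coeff_eq_zero_of_natDegree_lt (by omega)
    simp [homForm_zero_right, branchPoints, this]
  | coe a =>
    simp [homForm_one_right (show C.f.natDegree ≤ 2 * C.genus + 2 by omega), branchPoints]

theorem natDegree_homForm_linear_le (n : ℕ) (f : k[X]) (a b c d : k) :
    (homForm n f (C a * X + C b) (C c * X + C d) : k[X]).natDegree ≤ n := by
  refine natDegree_sum_le_of_forall_le _ _ fun i hi => ?_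
  have := Finset.mem_range.mp hi
  calc _ ≤ 0 + i * 1 + (n - i) * 1 := by
        refine natDegree_mul_le_of_le (natDegree_mul_le_of_le ?_ ?_) ?_
        · simp
        · exact natDegree_pow_le_of_le _ natDegree_linear_le
        · exact natDegree_pow_le_of_le _ natDegree_linear_le
    _ = n := by omega

/-- The top coefficient is the value of the form at `(a, c)`, the image of `∞` under the Möbius map.
-/
theorem coeff_homForm_linear (n : ℕ) (f : k[X]) (a b c d : k) :
    (homForm n f (C a * X + C b) (C c * X + C d) : k[X]).coeff n = homForm n f a c := by
  simp only [homForm, finsetSum_coeff]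
  refine Finset.sum_congr rfl fun i hi => ?_
  obtain ⟨j, rfl⟩ := Nat.exists_eq_add_of_le (Nat.lt_succ_iff.mp (Finset.mem_range.mp hi))
  have hlin : ∀ (a b : k) (l : ℕ), ((C a * X + C b) ^ l).natDegree ≤ l ∧
      ((C a * X + C b) ^ l).coeff l = a ^ l := by
    intro a b l
    have h1 : (C a * X + C b).natDegree ≤ 1 := natDegree_linear_le
    constructor
    · simpa using natDegree_pow_le_of_le l h1
    · have := coeff_pow_of_natDegree_le (m := l) h1
      simpa using this
  rw [Nat.add_sub_cancel_left, mul_assoc, algebraMap_eq, coeff_C_mul,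
    coeff_mul_add_eq_of_natDegree_le (hlin a b i).1 (hlin c d j).1, (hlin a b i).2, (hlin c d j).2]
  simp [mul_assoc]

theorem homForm_mobius_eq_zero {n m : ℕ} {f f' : k[X]} {a b c d : k} {s : k[X]} (hs : s ≠ 0)
    (hf : f.natDegree = 2 * n + 1 ∨ f.natDegree = 2 * n + 2)
    (h : (homForm (2 * m + 2) f' (C a * X + C b) (C c * X + C d) : k[X]) = s ^ 2 * f)
    {P : OnePoint k} (hP : homForm (2 * n + 2) f (homX P) (homY P) = 0) :
    homForm (2 * m + 2) f' (a * homX P + b * homY P) (c * homX P + d * homY P) = 0 := by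
  have hf0 : f ≠ 0 := by rintro rfl; simp at hf
  induction P using OnePoint.rec with
  | infty =>
    have hcoeff : f.coeff (2 * n + 2) = 0 := by
      simpa [homForm_zero_right] using hP
    have hdeg : f.natDegree = 2 * n + 1 := by
      refine hf.resolve_right fun h' => hf0 ?_
      rwa [← h', coeff_natDegree, leadingCoeff_eq_zero] at hcoeff
    have h1 := natDegree_homForm_linear_le (2 * m + 2) f' a b c d
    have h2 := coeff_homForm_linear (2 * m + 2) f' a b c d
    rw [h] at h1 h2
    have h3 : (s ^ 2 * f).natDegree = 2 * s.natDegree + (2 * n + 1) := by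
      rw [natDegree_mul (pow_ne_zero 2 hs) hf0, natDegree_pow, hdeg]
    -- Parity: `s² f` has odd degree at most `2m + 2`, hence smaller than `2m + 2`.
    rw [coeff_eq_zero_of_natDegree_lt (by omega)] at h2
    simp [← h2]
  | coe t =>
    have h1 := congrArg (aeval t) h
    rw [map_homForm] at h1
    have h2 : f.eval t = 0 := by
      rw [homX_coe, homY_coe, homForm_one_right (by omega)] at hP
      simpa using hP
    simpa [h2] using h1

end HomForm

/-! ### Isomorphisms of function fields -/

section Isomorphisms

variable {k F : Type*} [Field k] [Field F] [Algebra k F]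

open IntermediateField

namespace IsQuadraticOver

variable {f f' : k[X]} {x y u v : F}

theorem exists_mobius_homForm (h2 : (2 : k) ≠ 0) (h : IsQuadraticOver f x y)
    (h' : IsQuadraticOver f' u v) (hf : Squarefree f) {m : ℕ} (hm : f'.natDegree ≤ 2 * m + 2)
    (hu : u ∈ k⟮x⟯) :
    ∃ (a b c d : k) (s : k[X]), a * d - b * c ≠ 0 ∧ s ≠ 0 ∧
      u * (algebraMap k F c * x + algebraMap k F d) = algebraMap k F a * x + algebraMap k F b ∧
      (homForm (2 * m + 2) f' (C a * X + C b) (C c * X + C d) : k[X]) = s ^ 2 * f := by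
  obtain ⟨a, b, c, d, hdet, hmob⟩ := h.exists_mobius h' hu
  have hv : v ∉ k⟮x⟯ := fun hv => h'.notMem
    (adjoin_simple_le_iff.mpr (h.mem_adjoin_of_mem_adjoin h' hu) hv)
  have hv2 : v ^ 2 ∈ k⟮x⟯ := by
    rw [h'.sq]
    exact adjoin_simple_le_iff.mpr hu (aeval_mem_adjoin u f')
  obtain ⟨B, hB, rfl⟩ := (h.mem_or_eq_mul_of_sq_mem h2 hv2).resolve_left hv
  set Q := algebraMap k F c * x + algebraMap k F d with hQ
  have hQa : aeval x (C c * X + C d) = Q := by simp [hQ]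
  have hPa : aeval x (C a * X + C b) = Q * u := by
    rw [mul_comm Q, hmob]; simp
  have hQ0 : Q ≠ 0 := by
    intro h0
    have := eq_zero_of_aeval_eq_zero h.transcendental (hQa.trans h0)
    have hc : c = 0 := by simpa using congrArg (coeff · 1) this
    have hd : d = 0 := by simpa using congrArg (coeff · 0) this
    simp [hc, hd] at hdet
  -- Substitute `v = B y` in `v² = f'(u)` and clear denominators by `Q ^ (2m + 2)`; the even
  -- exponent keeps the cofactor of `f` a square.
  have key : aeval x (homForm (2 * m + 2) f' (C a * X + C b) (C c * X + C d) : k[X]) =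
      (Q ^ (m + 1) * B) ^ 2 * aeval x f := by
    rw [map_homForm, hPa, hQa, homForm_mul_right hm, ← h'.sq, ← h.sq]
    ring
  have hQm : Q ∈ k⟮x⟯ := hQa ▸ aeval_mem_adjoin x _
  obtain ⟨s, hs⟩ := exists_eq_sq_mul_of_aeval hf h.transcendental
    (mul_mem (pow_mem hQm (m + 1)) hB) key
  refine ⟨a, b, c, d, s, hdet, ?_, hmob, hs⟩
  rintro rfl
  rw [hs, ← h.sq] at key
  have h0 : (Q ^ (m + 1) * (B * y)) ^ 2 = 0 := by
    rw [← mul_assoc, mul_pow, ← key]; simp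
  have h1 : B * y = 0 := by simpa [hQ0] using h0
  exact hv (h1 ▸ zero_mem _)

/-- The discriminant of a quadratic equation for a function outside `k(x)`. -/
theorem exists_discrim_eq (h2 : (2 : k) ≠ 0) (h : IsQuadraticOver f x y) (hf : Squarefree f)
    (hu : u ∉ k⟮x⟯) {p q r : k[X]} (hpqr : p ≠ 0 ∨ q ≠ 0 ∨ r ≠ 0)
    (hrel : aeval x p * u ^ 2 + aeval x q * u + aeval x r = 0) :
    ∃ s ≠ 0, q ^ 2 - 4 * p * r = s ^ 2 * f := by
  have h2F : (2 : F) ≠ 0 := by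
    have := (map_ne_zero (algebraMap k F)).mpr h2
    rwa [map_ofNat] at this
  have hinj := transcendental_iff_injective.mp h.transcendental
  have hm := aeval_mem_adjoin (k := k) x
  have hp : aeval x p ≠ 0 := by
    intro hp
    rw [hp, zero_mul, zero_add] at hrel
    by_cases hq : aeval x q = 0
    · rw [hq, zero_mul, zero_add] at hrel
      rw [map_eq_zero_iff _ hinj] at hp hq hrel
      simp [hp, hq, hrel] at hpqr
    · refine hu ?_
      have : u = -aeval x r / aeval x q := by
        rw [eq_div_iff hq]; linear_combination hrel
      rw [this]
      exact div_mem (neg_mem (hm r)) (hm q)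
  -- Completing the square: `w²` is the discriminant, and `w` lies outside `k(x)` because `u` does,
  -- so `w` is a multiple of `y`.
  set w := 2 * aeval x p * u + aeval x q with hw
  have hw2 : w ^ 2 = aeval x (q ^ 2 - 4 * p * r) := by
    simp only [map_sub, map_mul, map_pow, map_ofNat, hw]
    linear_combination 4 * aeval x p * hrel
  have h2p : aeval x (2 * p) = 2 * aeval x p := by rw [map_mul, map_ofNat]
  have hwm : w ∉ k⟮x⟯ := by
    intro hwm
    apply hu
    have : u = (w - aeval x q) / aeval x (2 * p) := by
      rw [h2p, eq_div_iff (mul_ne_zero h2F hp), hw]; ring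
    rw [this]
    exact div_mem (sub_mem hwm (hm q)) (hm _)
  obtain ⟨B, hB, hwB⟩ := (h.mem_or_eq_mul_of_sq_mem h2 (hw2 ▸ hm _)).resolve_left hwm
  obtain ⟨s, hs⟩ := exists_eq_sq_mul_of_aeval (D := q ^ 2 - 4 * p * r) hf h.transcendental hB
    (by rw [← hw2, hwB, ← h.sq]; ring)
  refine ⟨s, ?_, hs⟩
  rintro rfl
  rw [hs] at hw2
  have : w = 0 := by simpa using hw2
  exact hwm (this ▸ zero_mem _)

end IsQuadraticOver

/-- The quadratic polynomial with given coefficients. -/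
noncomputable def quadraticPoly (a : Fin 3 → k) : k[X] := C (a 2) * X ^ 2 + C (a 1) * X + C (a 0)

/-- The discriminant of `∑ n j i X ^ i U ^ j` as a quadratic polynomial in `U`. -/
noncomputable def biquadraticDiscrim (n : Fin 3 → Fin 3 → k) : k[X] :=
  quadraticPoly (n 1) ^ 2 - 4 * quadraticPoly (n 2) * quadraticPoly (n 0)

theorem natDegree_quadraticPoly_le (a : Fin 3 → k) : (quadraticPoly a).natDegree ≤ 2 := by
  unfold quadraticPoly; compute_degree

theorem quadraticPoly_eq_zero {a : Fin 3 → k} (h : quadraticPoly a = 0) : a = 0 := by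
  have h' : ∀ i : ℕ, (quadraticPoly a).coeff i = 0 := by simp [h]
  funext i
  fin_cases i
  · simpa [quadraticPoly, coeff_X] using h' 0
  · simpa [quadraticPoly, coeff_X] using h' 1
  · simpa [quadraticPoly, coeff_X] using h' 2

theorem eq_quadraticPoly_coeff {p : k[X]} (hp : p.natDegree ≤ 2) :
    p = quadraticPoly fun i => p.coeff i := by
  conv_lhs => rw [p.as_sum_range_C_mul_X_pow' (Nat.lt_succ_of_le hp)]
  simp only [Finset.sum_range_succ, Finset.sum_range_zero, quadraticPoly]
  simp only [Fin.isValue, Fin.val_zero, Fin.val_one, Fin.val_two]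
  ring

theorem natDegree_biquadraticDiscrim_le (n : Fin 3 → Fin 3 → k) :
    (biquadraticDiscrim n).natDegree ≤ 4 := by
  have h := fun i => natDegree_quadraticPoly_le (n i)
  refine (natDegree_sub_le_of_le (natDegree_pow_le_of_le 2 (h 1)) (n := 4) ?_).trans (max_self 4).le
  calc _ ≤ 0 + 2 + 2 := natDegree_mul_le_of_le
        (natDegree_mul_le_of_le (natDegree_ofNat 4).le (h 2)) (h 0)
    _ = 4 := rfl

/-- Since `deg f ≥ 3`, the bound `2 deg s + deg f ≤ 4` leaves only constant `s` and genus one. -/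
theorem exists_C_mul_eq_of_sq_mul_eq {f s : k[X]} {g : ℕ} (hg : 1 ≤ g)
    (hf : f.natDegree = 2 * g + 1 ∨ f.natDegree = 2 * g + 2) (hs : s ≠ 0)
    (h : (s ^ 2 * f).natDegree ≤ 4) : g = 1 ∧ ∃ c ≠ 0, s ^ 2 * f = C c * f := by
  have hf0 : f ≠ 0 := by rintro rfl; simp at hf
  rw [natDegree_mul (pow_ne_zero 2 hs) hf0, natDegree_pow] at h
  refine ⟨by omega, s.coeff 0 ^ 2, pow_ne_zero 2 ?_, ?_⟩
  · intro h0
    apply hs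
    rw [eq_C_of_natDegree_eq_zero (p := s) (by omega), h0, C_0]
  · conv_lhs => rw [eq_C_of_natDegree_eq_zero (p := s) (by omega), ← C_pow]

theorem IsQuadraticOver.exists_biquadratic_relation (h2 : (2 : k) ≠ 0) {f f' : k[X]} {x y u v : F}
    (h : IsQuadraticOver f x y) (h' : IsQuadraticOver f' u v) (hf : Squarefree f)
    (hf' : Squarefree f') {g g' : ℕ} (hg : 1 ≤ g) (hg' : 1 ≤ g')
    (hd : f.natDegree = 2 * g + 1 ∨ f.natDegree = 2 * g + 2)
    (hd' : f'.natDegree = 2 * g' + 1 ∨ f'.natDegree = 2 * g' + 2) (hu : u ∉ k⟮x⟯) :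
    g = 1 ∧ g' = 1 ∧ ∃ n : Fin 3 → Fin 3 → k,
      aeval x (quadraticPoly (n 2)) * u ^ 2 + aeval x (quadraticPoly (n 1)) * u +
        aeval x (quadraticPoly (n 0)) = 0 ∧
      (∃ s ≠ 0, biquadraticDiscrim n = C s * f) ∧
      ∃ t ≠ 0, biquadraticDiscrim (fun i j => n j i) = C t * f' := by
  have hx : x ∉ k⟮u⟯ := fun hx => hu (h'.mem_adjoin_of_mem_adjoin h hx)
  obtain ⟨H, hH, hH2, hHu⟩ := h.exists_quadratic_relation u
  obtain ⟨G, hG, hG2, hGx⟩ := h'.exists_quadratic_relation x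
  obtain ⟨N, hN, hN2, hNi, hNu⟩ := exists_relation h.transcendental hH hH2 hHu hG hG2 hGx
  set n : Fin 3 → Fin 3 → k := fun j i => (N.coeff j).coeff i with hn
  have hNn : ∀ j : Fin 3, N.coeff j = quadraticPoly (n j) :=
    fun j => eq_quadraticPoly_coeff (hNi j)
  have hNe : N = C (quadraticPoly (n 2)) * X ^ 2 + C (quadraticPoly (n 1)) * X +
      C (quadraticPoly (n 0)) := by
    conv_lhs => rw [N.as_sum_range_C_mul_X_pow' (Nat.lt_succ_of_le hN2)]
    rw [← hNn, ← hNn, ← hNn]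
    simp only [Finset.sum_range_succ, Finset.sum_range_zero, Fin.isValue, Fin.val_zero,
      Fin.val_one, Fin.val_two]
    ring
  have hn0 : n ≠ 0 := by
    intro h0
    apply hN
    rw [hNe, h0]
    simp [quadraticPoly]
  have hrel : aeval x (quadraticPoly (n 2)) * u ^ 2 + aeval x (quadraticPoly (n 1)) * u +
      aeval x (quadraticPoly (n 0)) = 0 := by
    rw [hNe] at hNu
    simpa only [map_add, map_mul, map_pow, aevalAeval_C, aevalAeval_Y] using hNu
  -- The same relation, now read as a quadratic equation for `x` over `k(u)`; its coefficient matrix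
  -- is the transpose.
  have hrel' : aeval u (quadraticPoly fun j => n j 2) * x ^ 2 +
      aeval u (quadraticPoly fun j => n j 1) * x + aeval u (quadraticPoly fun j => n j 0) = 0 := by
    simp only [quadraticPoly, map_add, map_mul, map_pow, aeval_C, aeval_X] at hrel ⊢
    linear_combination hrel
  have hne : quadraticPoly (n 2) ≠ 0 ∨ quadraticPoly (n 1) ≠ 0 ∨ quadraticPoly (n 0) ≠ 0 := by
    by_contra! h0
    apply hn0
    funext j
    fin_cases j
    exacts [quadraticPoly_eq_zero h0.2.2, quadraticPoly_eq_zero h0.2.1, quadraticPoly_eq_zero h0.1]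
  have hne' : quadraticPoly (fun j => n j 2) ≠ 0 ∨ quadraticPoly (fun j => n j 1) ≠ 0 ∨
      quadraticPoly (fun j => n j 0) ≠ 0 := by
    by_contra! h0
    apply hn0
    funext j i
    fin_cases i
    exacts [congrFun (quadraticPoly_eq_zero h0.2.2) j, congrFun (quadraticPoly_eq_zero h0.2.1) j,
      congrFun (quadraticPoly_eq_zero h0.1) j]
  obtain ⟨s, hs, hsD⟩ := h.exists_discrim_eq h2 hf hu hne hrel
  obtain ⟨t, ht, htD⟩ := h'.exists_discrim_eq h2 hf' hx hne' hrel'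
  obtain ⟨h1, c, hc, hcf⟩ := exists_C_mul_eq_of_sq_mul_eq hg hd hs
    (hsD ▸ natDegree_biquadraticDiscrim_le n)
  obtain ⟨h1', c', hc', hcf'⟩ := exists_C_mul_eq_of_sq_mul_eq hg' hd' ht
    (htD ▸ natDegree_biquadraticDiscrim_le fun i j => n j i)
  exact ⟨h1, h1', n, hrel, ⟨c, hc, hsD.trans hcf⟩, c', hc', htD.trans hcf'⟩

end Isomorphisms

/-! ### Invariants of binary quartic forms -/

section Invariants

variable {R : Type*} [CommRing R]

/-- The invariant of degree 2 of a binary quartic form. -/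
def quarticI (a b c d e : R) : R := 12 * a * e - 3 * b * d + c ^ 2

/-- The invariant of degree 3 of a binary quartic form. -/
def quarticJ (a b c d e : R) : R :=
  72 * a * c * e + 9 * b * c * d - 27 * a * d ^ 2 - 27 * e * b ^ 2 - 2 * c ^ 3

/-- The discriminant of a binary quartic form. -/
def quarticDelta (a b c d e : R) : R :=
  256 * a ^ 3 * e ^ 3 - 192 * a ^ 2 * b * d * e ^ 2 - 128 * a ^ 2 * c ^ 2 * e ^ 2 +
  144 * a ^ 2 * c * d ^ 2 * e - 27 * a ^ 2 * d ^ 4 + 144 * a * b ^ 2 * c * e ^ 2 -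
  6 * a * b ^ 2 * d ^ 2 * e - 80 * a * b * c ^ 2 * d * e + 18 * a * b * c * d ^ 3 +
  16 * a * c ^ 4 * e - 4 * a * c ^ 3 * d ^ 2 - 27 * b ^ 4 * e ^ 2 + 18 * b ^ 3 * c * d * e -
  4 * b ^ 3 * d ^ 3 - 4 * b ^ 2 * c ^ 3 * e + b ^ 2 * c ^ 2 * d ^ 2

/-- Over a ring where 27 is cancellable, `I` and `J` determine the discriminant. In characteristic 3
they do not, which is why `Δ` rather than `J` is compared later. -/
theorem twentySeven_mul_quarticDelta (a b c d e : R) :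
    27 * quarticDelta a b c d e = 4 * quarticI a b c d e ^ 3 - quarticJ a b c d e ^ 2 := by
  unfold quarticDelta quarticI quarticJ; ring

/-- With roots `(u_i : v_i)`, the three products of complementary determinants, scaled by `c`, sum
to zero. `I` is minus their second elementary symmetric function, written in the first two of them;
the discriminant is the square of their product. -/
theorem quarticI_of_roots (c u₁ u₂ u₃ u₄ v₁ v₂ v₃ v₄ : R) :
    quarticI (c * (v₁ * v₂ * v₃ * v₄))
      (-c * (u₁ * v₂ * v₃ * v₄ + v₁ * u₂ * v₃ * v₄ + v₁ * v₂ * u₃ * v₄ + v₁ * v₂ * v₃ * u₄))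
      (c * (u₁ * u₂ * v₃ * v₄ + u₁ * v₂ * u₃ * v₄ + u₁ * v₂ * v₃ * u₄ + v₁ * u₂ * u₃ * v₄ +
        v₁ * u₂ * v₃ * u₄ + v₁ * v₂ * u₃ * u₄))
      (-c * (v₁ * u₂ * u₃ * u₄ + u₁ * v₂ * u₃ * u₄ + u₁ * u₂ * v₃ * u₄ + u₁ * u₂ * u₃ * v₄))
      (c * (u₁ * u₂ * u₃ * u₄)) =
    (c * ((u₁ * v₂ - u₂ * v₁) * (u₃ * v₄ - u₄ * v₃))) ^ 2 +
      (c * ((u₁ * v₂ - u₂ * v₁) * (u₃ * v₄ - u₄ * v₃))) *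
      (c * ((u₁ * v₃ - u₃ * v₁) * (u₄ * v₂ - u₂ * v₄))) +
      (c * ((u₁ * v₃ - u₃ * v₁) * (u₄ * v₂ - u₂ * v₄))) ^ 2 := by
  unfold quarticI; ring

set_option maxHeartbeats 4000000 in
theorem quarticDelta_of_roots (c u₁ u₂ u₃ u₄ v₁ v₂ v₃ v₄ : R) :
    quarticDelta (c * (v₁ * v₂ * v₃ * v₄))
      (-c * (u₁ * v₂ * v₃ * v₄ + v₁ * u₂ * v₃ * v₄ + v₁ * v₂ * u₃ * v₄ + v₁ * v₂ * v₃ * u₄))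
      (c * (u₁ * u₂ * v₃ * v₄ + u₁ * v₂ * u₃ * v₄ + u₁ * v₂ * v₃ * u₄ + v₁ * u₂ * u₃ * v₄ +
        v₁ * u₂ * v₃ * u₄ + v₁ * v₂ * u₃ * u₄))
      (-c * (v₁ * u₂ * u₃ * u₄ + u₁ * v₂ * u₃ * u₄ + u₁ * u₂ * v₃ * u₄ + u₁ * u₂ * u₃ * v₄))
      (c * (u₁ * u₂ * u₃ * u₄)) =
    ((c * ((u₁ * v₂ - u₂ * v₁) * (u₃ * v₄ - u₄ * v₃))) *
      (c * ((u₁ * v₃ - u₃ * v₁) * (u₄ * v₂ - u₂ * v₄))) *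
      (c * ((u₁ * v₄ - u₄ * v₁) * (u₂ * v₃ - u₃ * v₂)))) ^ 2 := by
  unfold quarticDelta; ring

/-- The two discriminants of a biquadratic polynomial have the same invariant `I`. -/
theorem quarticI_biquadratic (a₀ a₁ a₂ b₀ b₁ b₂ c₀ c₁ c₂ : R) :
    quarticI (b₂ ^ 2 - 4 * a₂ * c₂) (2 * b₁ * b₂ - 4 * (a₁ * c₂ + a₂ * c₁))
      (b₁ ^ 2 + 2 * b₀ * b₂ - 4 * (a₀ * c₂ + a₁ * c₁ + a₂ * c₀))
      (2 * b₀ * b₁ - 4 * (a₀ * c₁ + a₁ * c₀)) (b₀ ^ 2 - 4 * a₀ * c₀) =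
    quarticI (a₁ ^ 2 - 4 * a₀ * a₂) (2 * a₁ * b₁ - 4 * (a₀ * b₂ + a₂ * b₀))
      (b₁ ^ 2 + 2 * a₁ * c₁ - 4 * (a₀ * c₂ + b₀ * b₂ + c₀ * a₂))
      (2 * b₁ * c₁ - 4 * (b₀ * c₂ + c₀ * b₂)) (c₁ ^ 2 - 4 * c₀ * c₂) := by
  unfold quarticI; ring

/-- The two discriminants of a biquadratic polynomial have the same invariant `J`. -/
theorem quarticJ_biquadratic (a₀ a₁ a₂ b₀ b₁ b₂ c₀ c₁ c₂ : R) :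
    quarticJ (b₂ ^ 2 - 4 * a₂ * c₂) (2 * b₁ * b₂ - 4 * (a₁ * c₂ + a₂ * c₁))
      (b₁ ^ 2 + 2 * b₀ * b₂ - 4 * (a₀ * c₂ + a₁ * c₁ + a₂ * c₀))
      (2 * b₀ * b₁ - 4 * (a₀ * c₁ + a₁ * c₀)) (b₀ ^ 2 - 4 * a₀ * c₀) =
    quarticJ (a₁ ^ 2 - 4 * a₀ * a₂) (2 * a₁ * b₁ - 4 * (a₀ * b₂ + a₂ * b₀))
      (b₁ ^ 2 + 2 * a₁ * c₁ - 4 * (a₀ * c₂ + b₀ * b₂ + c₀ * a₂))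
      (2 * b₁ * c₁ - 4 * (b₀ * c₂ + c₀ * b₂)) (c₁ ^ 2 - 4 * c₀ * c₂) := by
  unfold quarticJ; ring

end Invariants

/-! ### Quadruples of points with equal invariants -/

section FourPoints

variable {k : Type*} [Field k]

/-- Each cross ratio of four points is, up to sign, a quotient of two of the three products of
complementary determinants, so proportional triples suffice. -/
theorem sameCrossRatios_of_four {α β : Fin 4 → OnePoint k} {l : k}
    (hA : bracket (β 0) (β 1) * bracket (β 2) (β 3) =
      l * (bracket (α 0) (α 1) * bracket (α 2) (α 3)))
    (hB : bracket (β 0) (β 2) * bracket (β 3) (β 1) =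
      l * (bracket (α 0) (α 2) * bracket (α 3) (α 1)))
    (hC : bracket (β 0) (β 3) * bracket (β 1) (β 2) =
      l * (bracket (α 0) (α 3) * bracket (α 1) (α 2))) :
    SameCrossRatios α β := by
  have s1 := fun γ : Fin 4 → OnePoint k => bracket_swap (γ 1) (γ 0)
  have s2 := fun γ : Fin 4 → OnePoint k => bracket_swap (γ 2) (γ 0)
  have s3 := fun γ : Fin 4 → OnePoint k => bracket_swap (γ 3) (γ 0)
  have s4 := fun γ : Fin 4 → OnePoint k => bracket_swap (γ 2) (γ 1)
  have s5 := fun γ : Fin 4 → OnePoint k => bracket_swap (γ 3) (γ 1)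
  have s6 := fun γ : Fin 4 → OnePoint k => bracket_swap (γ 3) (γ 2)
  simp only [s5] at hB
  have hAB : bracket (β 0) (β 1) * bracket (β 2) (β 3) *
        (bracket (α 0) (α 2) * bracket (α 1) (α 3)) =
      bracket (α 0) (α 1) * bracket (α 2) (α 3) * (bracket (β 0) (β 2) * bracket (β 1) (β 3)) := by
    linear_combination bracket (α 0) (α 2) * bracket (α 1) (α 3) * hA +
      bracket (α 0) (α 1) * bracket (α 2) (α 3) * hB
  have hBC : bracket (β 0) (β 3) * bracket (β 1) (β 2) *
        (bracket (α 0) (α 2) * bracket (α 1) (α 3)) =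
      bracket (α 0) (α 3) * bracket (α 1) (α 2) * (bracket (β 0) (β 2) * bracket (β 1) (β 3)) := by
    linear_combination bracket (α 0) (α 2) * bracket (α 1) (α 3) * hC +
      bracket (α 0) (α 3) * bracket (α 1) (α 2) * hB
  have hAC : bracket (β 0) (β 3) * bracket (β 1) (β 2) *
        (bracket (α 0) (α 1) * bracket (α 2) (α 3)) =
      bracket (α 0) (α 3) * bracket (α 1) (α 2) * (bracket (β 0) (β 1) * bracket (β 2) (β 3)) := by
    linear_combination bracket (α 0) (α 1) * bracket (α 2) (α 3) * hC -
      bracket (α 0) (α 3) * bracket (α 1) (α 2) * hA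
  intro i j m n
  fin_cases i <;> fin_cases j <;> fin_cases m <;> fin_cases n <;> intro h1 h2 h3 h4 h5 h6 <;>
    first
    | exact absurd rfl h1
    | exact absurd rfl h2
    | exact absurd rfl h3
    | exact absurd rfl h4
    | exact absurd rfl h5
    | exact absurd rfl h6
    | (simp only [Fin.zero_eta, Fin.mk_one, Fin.reduceFinMk, s1, s2, s3, s4, s5, s6]
       first
       | linear_combination hAB
       | linear_combination -hAB
       | linear_combination hBC
       | linear_combination -hBC
       | linear_combination hAC
       | linear_combination -hAC)

/-- Four points are determined up to order and projective equivalence by the two invariants of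
the binary quartic form with these zeros. -/
theorem exists_perm_sameCrossRatios {α β : Fin 4 → OnePoint k} {c d : k} (hd : d ≠ 0)
    (hI : (c * (bracket (α 0) (α 1) * bracket (α 2) (α 3))) ^ 2 +
        (c * (bracket (α 0) (α 1) * bracket (α 2) (α 3))) *
        (c * (bracket (α 0) (α 2) * bracket (α 3) (α 1))) +
        (c * (bracket (α 0) (α 2) * bracket (α 3) (α 1))) ^ 2 =
      (d * (bracket (β 0) (β 1) * bracket (β 2) (β 3))) ^ 2 +
        (d * (bracket (β 0) (β 1) * bracket (β 2) (β 3))) *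
        (d * (bracket (β 0) (β 2) * bracket (β 3) (β 1))) +
        (d * (bracket (β 0) (β 2) * bracket (β 3) (β 1))) ^ 2)
    (hD : ((c * (bracket (α 0) (α 1) * bracket (α 2) (α 3))) *
        (c * (bracket (α 0) (α 2) * bracket (α 3) (α 1))) *
        (c * (bracket (α 0) (α 3) * bracket (α 1) (α 2)))) ^ 2 =
      ((d * (bracket (β 0) (β 1) * bracket (β 2) (β 3))) *
        (d * (bracket (β 0) (β 2) * bracket (β 3) (β 1))) *
        (d * (bracket (β 0) (β 3) * bracket (β 1) (β 2)))) ^ 2) :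
    ∃ e : Equiv.Perm (Fin 4), SameCrossRatios α (fun i => β (e i)) := by
  have hp : ∀ γ : Fin 4 → OnePoint k, bracket (γ 0) (γ 1) * bracket (γ 2) (γ 3) +
      bracket (γ 0) (γ 2) * bracket (γ 3) (γ 1) + bracket (γ 0) (γ 3) * bracket (γ 1) (γ 2) = 0 := by
    intro γ; unfold bracket; ring
  have hpα := hp α
  have hpβ := hp β
  have e0 : ∀ i : Fin 4, (1 : Equiv.Perm (Fin 4)) i = i := fun _ => rfl
  -- The three products correspond to the partner 1, 2 or 3 of the point 0. Permutations fixing 0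
  -- therefore permute them in all six ways, odd ones with an additional sign that `l` absorbs.
  have key : ∀ (e : Equiv.Perm (Fin 4)) (l : k),
      (e 0 = 0) →
      (d * (bracket (β 0) (β (e 1)) * bracket (β (e 2)) (β (e 3))) =
        l * (c * (bracket (α 0) (α 1) * bracket (α 2) (α 3)))) →
      (d * (bracket (β 0) (β (e 2)) * bracket (β (e 3)) (β (e 1))) =
        l * (c * (bracket (α 0) (α 2) * bracket (α 3) (α 1)))) →
      (d * (bracket (β 0) (β (e 3)) * bracket (β (e 1)) (β (e 2))) =
        l * (c * (bracket (α 0) (α 3) * bracket (α 1) (α 2)))) →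
      ∃ e : Equiv.Perm (Fin 4), SameCrossRatios α (fun i => β (e i)) := by
    intro e l he hA hB hC
    refine ⟨e, sameCrossRatios_of_four (l := d⁻¹ * l * c) ?_ ?_ ?_⟩ <;>
      simp only [he] <;> apply mul_left_cancel₀ hd <;> simp only [← mul_assoc] at * <;>
      rw [mul_inv_cancel₀ hd, one_mul] <;> assumption
  have k1 := key 1
  have k2 := key (Equiv.swap 2 3)
  have k3 := key (Equiv.swap 1 2)
  have k4 := key (Equiv.swap 1 3)
  have k5 := key (Equiv.swap 1 2 * Equiv.swap 2 3)
  have k6 := key (Equiv.swap 2 3 * Equiv.swap 1 2)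
  clear key
  rw [show (Equiv.swap 2 3 : Equiv.Perm (Fin 4)) 0 = 0 by decide,
    show (Equiv.swap 2 3 : Equiv.Perm (Fin 4)) 1 = 1 by decide,
    show (Equiv.swap 2 3 : Equiv.Perm (Fin 4)) 2 = 3 by decide,
    show (Equiv.swap 2 3 : Equiv.Perm (Fin 4)) 3 = 2 by decide] at k2
  rw [show (Equiv.swap 1 2 : Equiv.Perm (Fin 4)) 0 = 0 by decide,
    show (Equiv.swap 1 2 : Equiv.Perm (Fin 4)) 1 = 2 by decide,
    show (Equiv.swap 1 2 : Equiv.Perm (Fin 4)) 2 = 1 by decide,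
    show (Equiv.swap 1 2 : Equiv.Perm (Fin 4)) 3 = 3 by decide] at k3
  rw [show (Equiv.swap 1 3 : Equiv.Perm (Fin 4)) 0 = 0 by decide,
    show (Equiv.swap 1 3 : Equiv.Perm (Fin 4)) 1 = 3 by decide,
    show (Equiv.swap 1 3 : Equiv.Perm (Fin 4)) 2 = 2 by decide,
    show (Equiv.swap 1 3 : Equiv.Perm (Fin 4)) 3 = 1 by decide] at k4
  rw [show (Equiv.swap 1 2 * Equiv.swap 2 3 : Equiv.Perm (Fin 4)) 0 = 0 by decide,
    show (Equiv.swap 1 2 * Equiv.swap 2 3 : Equiv.Perm (Fin 4)) 1 = 2 by decide,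
    show (Equiv.swap 1 2 * Equiv.swap 2 3 : Equiv.Perm (Fin 4)) 2 = 3 by decide,
    show (Equiv.swap 1 2 * Equiv.swap 2 3 : Equiv.Perm (Fin 4)) 3 = 1 by decide] at k5
  rw [show (Equiv.swap 2 3 * Equiv.swap 1 2 : Equiv.Perm (Fin 4)) 0 = 0 by decide,
    show (Equiv.swap 2 3 * Equiv.swap 1 2 : Equiv.Perm (Fin 4)) 1 = 3 by decide,
    show (Equiv.swap 2 3 * Equiv.swap 1 2 : Equiv.Perm (Fin 4)) 2 = 1 by decide,
    show (Equiv.swap 2 3 * Equiv.swap 1 2 : Equiv.Perm (Fin 4)) 3 = 2 by decide] at k6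
  simp only [e0] at k1
  simp only [bracket_swap (β 3) (β 2), bracket_swap (β 2) (β 1), bracket_swap (β 1) (β 3)]
    at k2 k3 k4 k5 k6
  generalize bracket (α 0) (α 1) * bracket (α 2) (α 3) = A at *
  generalize bracket (α 0) (α 2) * bracket (α 3) (α 1) = B at *
  generalize bracket (α 0) (α 3) * bracket (α 1) (α 2) = G at *
  simp only [mul_neg] at k2 k3 k4 k5 k6
  generalize bracket (β 0) (β 1) * bracket (β 2) (β 3) = A' at *
  generalize bracket (β 0) (β 2) * bracket (β 3) (β 1) = B' at *
  generalize bracket (β 0) (β 3) * bracket (β 1) (β 2) = G' at *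
  -- The discriminants give the product of the three numbers only up to a sign `ε`.
  obtain ⟨ε, hε, hP⟩ : ∃ ε : k, ε * ε = 1 ∧
      (d * A') * (d * B') * (d * G') = ε * ((c * A) * (c * B) * (c * G)) := by
    rcases sq_eq_sq_iff_eq_or_eq_neg.mp hD with h | h
    · exact ⟨1, by simp, by rw [h, one_mul]⟩
    · exact ⟨-1, by simp, by rw [h]; ring⟩
  obtain rfl : G = -A - B := by linear_combination hpα
  obtain rfl : G' = -A' - B' := by linear_combination hpβ
  -- Both triples have sum zero and equal second symmetric functions, and after scaling one by `ε`
  -- also equal products. So they are the roots of one cubic, and it remains to see which root each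
  -- number is.
  have hroot : (d * A' - ε * (c * A)) * ((d * A' - ε * (c * B)) *
      (d * A' - ε * (c * (-A - B)))) = 0 := by
    linear_combination hP + (-(d * A')) * hI + (-(d * A') * (c ^ 2 * (A ^ 2 + A * B + B ^ 2)) +
      ε * ((c * A) * (c * B) * (c * (-A - B))) * (-1)) * hε
  rcases mul_eq_zero.mp hroot with h | h
  · have h' : (d * B' - ε * (c * B)) * (d * B' - ε * (c * (-A - B))) = 0 := by
      linear_combination -hI + c ^ 2 * ((B) * (-A - B) - (A) ^ 2) * hε -
        (d * B' + d * A' + ε * (c * (A))) * h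
    rcases mul_eq_zero.mp h' with h' | h'
    · exact k1 ε trivial (by linear_combination h) (by linear_combination h')
        (by linear_combination -h - h')
    · exact k2 (-ε) trivial (by linear_combination -h) (by linear_combination h + h')
        (by linear_combination -h')
  rcases mul_eq_zero.mp h with h | h
  · have h' : (d * B' - ε * (c * A)) * (d * B' - ε * (c * (-A - B))) = 0 := by
      linear_combination -hI + c ^ 2 * ((A) * (-A - B) - (B) ^ 2) * hε -
        (d * B' + d * A' + ε * (c * (B))) * h
    rcases mul_eq_zero.mp h' with h' | h'
    · exact k3 (-ε) trivial (by linear_combination -h') (by linear_combination -h)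
        (by linear_combination h + h')
    · exact k6 ε trivial (by linear_combination -h - h') (by linear_combination h)
        (by linear_combination h')
  · have h' : (d * B' - ε * (c * A)) * (d * B' - ε * (c * B)) = 0 := by
      linear_combination -hI + c ^ 2 * ((A) * (B) - (-A - B) ^ 2) * hε -
        (d * B' + d * A' + ε * (c * (-A - B))) * h
    rcases mul_eq_zero.mp h' with h' | h'
    · exact k5 ε trivial (by linear_combination h') (by linear_combination -h - h')
        (by linear_combination h)
    · exact k4 (-ε) trivial (by linear_combination h + h') (by linear_combination -h')
        (by linear_combination -h)

end FourPoints

/-! ### The two discriminants of a biquadratic polynomial -/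

section Biquadratic

theorem quarticDelta_biquadratic {R : Type*} [CommRing R] (n : Fin 3 → Fin 3 → R) :
    quarticDelta (n 1 2 ^ 2 - 4 * n 2 2 * n 0 2)
      (2 * n 1 1 * n 1 2 - 4 * (n 2 1 * n 0 2 + n 2 2 * n 0 1))
      (n 1 1 ^ 2 + 2 * n 1 0 * n 1 2 - 4 * (n 2 0 * n 0 2 + n 2 1 * n 0 1 + n 2 2 * n 0 0))
      (2 * n 1 0 * n 1 1 - 4 * (n 2 0 * n 0 1 + n 2 1 * n 0 0)) (n 1 0 ^ 2 - 4 * n 2 0 * n 0 0) =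
    quarticDelta (n 2 1 ^ 2 - 4 * n 2 0 * n 2 2)
      (2 * n 2 1 * n 1 1 - 4 * (n 2 0 * n 1 2 + n 2 2 * n 1 0))
      (n 1 1 ^ 2 + 2 * n 2 1 * n 0 1 - 4 * (n 2 0 * n 0 2 + n 1 0 * n 1 2 + n 0 0 * n 2 2))
      (2 * n 1 1 * n 0 1 - 4 * (n 1 0 * n 0 2 + n 0 0 * n 1 2)) (n 0 1 ^ 2 - 4 * n 0 0 * n 0 2) := by
  -- For generic coefficients over `ℤ` the factor 27 can be cancelled; specialization then gives the
  -- identity in every characteristic.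
  let N : Fin 3 → Fin 3 → MvPolynomial (Fin 3 × Fin 3) ℤ := fun i j => MvPolynomial.X (i, j)
  have h27 : (27 : MvPolynomial (Fin 3 × Fin 3) ℤ) ≠ 0 := by norm_num
  have h : quarticDelta (N 1 2 ^ 2 - 4 * N 2 2 * N 0 2)
      (2 * N 1 1 * N 1 2 - 4 * (N 2 1 * N 0 2 + N 2 2 * N 0 1))
      (N 1 1 ^ 2 + 2 * N 1 0 * N 1 2 - 4 * (N 2 0 * N 0 2 + N 2 1 * N 0 1 + N 2 2 * N 0 0))
      (2 * N 1 0 * N 1 1 - 4 * (N 2 0 * N 0 1 + N 2 1 * N 0 0)) (N 1 0 ^ 2 - 4 * N 2 0 * N 0 0) =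
    quarticDelta (N 2 1 ^ 2 - 4 * N 2 0 * N 2 2)
      (2 * N 2 1 * N 1 1 - 4 * (N 2 0 * N 1 2 + N 2 2 * N 1 0))
      (N 1 1 ^ 2 + 2 * N 2 1 * N 0 1 - 4 * (N 2 0 * N 0 2 + N 1 0 * N 1 2 + N 0 0 * N 2 2))
      (2 * N 1 1 * N 0 1 - 4 * (N 1 0 * N 0 2 + N 0 0 * N 1 2))
      (N 0 1 ^ 2 - 4 * N 0 0 * N 0 2) := by
    apply mul_left_cancel₀ h27
    rw [twentySeven_mul_quarticDelta, twentySeven_mul_quarticDelta, quarticI_biquadratic,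
      quarticJ_biquadratic]
  have h' := congrArg (MvPolynomial.aeval fun p : Fin 3 × Fin 3 => n p.1 p.2) h
  simpa only [quarticDelta, map_add, map_sub, map_mul, map_pow, map_ofNat, MvPolynomial.aeval_X, N]
    using h'

variable {k : Type*} [Field k]

theorem biquadraticDiscrim_eq (n : Fin 3 → Fin 3 → k) :
    biquadraticDiscrim n = C (n 1 2 ^ 2 - 4 * n 2 2 * n 0 2) * X ^ 4 +
      C (2 * n 1 1 * n 1 2 - 4 * (n 2 1 * n 0 2 + n 2 2 * n 0 1)) * X ^ 3 +
      C (n 1 1 ^ 2 + 2 * n 1 0 * n 1 2 -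
        4 * (n 2 0 * n 0 2 + n 2 1 * n 0 1 + n 2 2 * n 0 0)) * X ^ 2 +
      C (2 * n 1 0 * n 1 1 - 4 * (n 2 0 * n 0 1 + n 2 1 * n 0 0)) * X +
      C (n 1 0 ^ 2 - 4 * n 2 0 * n 0 0) := by
  simp only [biquadraticDiscrim, quadraticPoly, C_add, C_sub, C_mul, C_pow, map_ofNat]
  ring

theorem quartic_of_roots_eq (c : k) (α : Fin 4 → OnePoint k) :
    C c * ∏ i, (C (homY (α i)) * X - C (homX (α i))) =
    C (c * (homY (α 0) * homY (α 1) * homY (α 2) * homY (α 3))) * X ^ 4 +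
    C (-c * (homX (α 0) * homY (α 1) * homY (α 2) * homY (α 3) +
      homY (α 0) * homX (α 1) * homY (α 2) * homY (α 3) +
      homY (α 0) * homY (α 1) * homX (α 2) * homY (α 3) +
      homY (α 0) * homY (α 1) * homY (α 2) * homX (α 3))) * X ^ 3 +
    C (c * (homX (α 0) * homX (α 1) * homY (α 2) * homY (α 3) +
      homX (α 0) * homY (α 1) * homX (α 2) * homY (α 3) +
      homX (α 0) * homY (α 1) * homY (α 2) * homX (α 3) +
      homY (α 0) * homX (α 1) * homX (α 2) * homY (α 3) +
      homY (α 0) * homX (α 1) * homY (α 2) * homX (α 3) +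
      homY (α 0) * homY (α 1) * homX (α 2) * homX (α 3))) * X ^ 2 +
    C (-c * (homY (α 0) * homX (α 1) * homX (α 2) * homX (α 3) +
      homX (α 0) * homY (α 1) * homX (α 2) * homX (α 3) +
      homX (α 0) * homX (α 1) * homY (α 2) * homX (α 3) +
      homX (α 0) * homX (α 1) * homX (α 2) * homY (α 3))) * X +
    C (c * (homX (α 0) * homX (α 1) * homX (α 2) * homX (α 3))) := by
  simp only [Fin.prod_univ_four, C_add, C_neg, C_mul]
  ring

theorem quartic_coeffs_eq {a b c d e a' b' c' d' e' : k}
    (h : (C a * X ^ 4 + C b * X ^ 3 + C c * X ^ 2 + C d * X + C e : k[X]) =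
      C a' * X ^ 4 + C b' * X ^ 3 + C c' * X ^ 2 + C d' * X + C e') :
    a = a' ∧ b = b' ∧ c = c' ∧ d = d' ∧ e = e' := by
  have h' := fun i : ℕ => congrArg (coeff · i) h
  simp only [coeff_add, coeff_C_mul, coeff_X_pow, coeff_X, coeff_C] at h'
  refine ⟨?_, ?_, ?_, ?_, ?_⟩
  · simpa using h' 4
  · simpa using h' 3
  · simpa using h' 2
  · simpa using h' 1
  · simpa using h' 0

/-- The zeros of the two discriminants of a biquadratic polynomial are projectively equivalent. -/
theorem exists_perm_of_biquadraticDiscrim {n : Fin 3 → Fin 3 → k} {α β : Fin 4 → OnePoint k}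
    {c d : k} (hd : d ≠ 0)
    (hα : biquadraticDiscrim n = C c * ∏ i, (C (homY (α i)) * X - C (homX (α i))))
    (hβ : biquadraticDiscrim (fun i j => n j i) =
      C d * ∏ i, (C (homY (β i)) * X - C (homX (β i)))) :
    ∃ e : Equiv.Perm (Fin 4), SameCrossRatios α (fun i => β (e i)) := by
  rw [biquadraticDiscrim_eq, quartic_of_roots_eq] at hα hβ
  obtain ⟨a4, a3, a2, a1, a0⟩ := quartic_coeffs_eq hα
  obtain ⟨b4, b3, b2, b1, b0⟩ := quartic_coeffs_eq hβ
  have hI := quarticI_biquadratic (n 2 0) (n 2 1) (n 2 2) (n 1 0) (n 1 1) (n 1 2) (n 0 0) (n 0 1)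
    (n 0 2)
  have hD := quarticDelta_biquadratic n
  rw [a4, a3, a2, a1, a0, quarticI_of_roots] at hI
  rw [a4, a3, a2, a1, a0, quarticDelta_of_roots] at hD
  have hI' := quarticI_of_roots d (homX (β 0)) (homX (β 1)) (homX (β 2)) (homX (β 3))
    (homY (β 0)) (homY (β 1)) (homY (β 2)) (homY (β 3))
  have hD' := quarticDelta_of_roots d (homX (β 0)) (homX (β 1)) (homX (β 2)) (homX (β 3))
    (homY (β 0)) (homY (β 1)) (homY (β 2)) (homY (β 3))
  rw [← b4, ← b3, ← b2, ← b1, ← b0] at hI' hD'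
  refine exists_perm_sameCrossRatios hd (hI.trans (Eq.trans ?_ hI')) (hD.trans (Eq.trans ?_ hD'))
  · congr 1 <;> ring
  · congr 1 <;> ring

end Biquadratic

/-! ### Labellings of the branch points -/

section Labellings

namespace HyperellipticCurve

theorem baseChange_baseChange {K L M : Type*} [Field K] [Field L] [Field M] [Algebra K L]
    [Algebra L M] [Algebra K M] [IsScalarTower K L M] (C : HyperellipticCurve K) :
    (C.baseChange L).baseChange M = C.baseChange M := by
  simp [baseChange, Polynomial.map_map, ← IsScalarTower.algebraMap_eq]

variable {k : Type*} [Field k]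

theorem homX_ne_zero_or_homY_ne_zero (P : OnePoint k) : homX P ≠ 0 ∨ homY P ≠ 0 := by
  induction P using OnePoint.rec <;> simp

theorem linear_ne_zero {a b c d u v : k} (hdet : a * d - b * c ≠ 0) (h : u ≠ 0 ∨ v ≠ 0) :
    a * u + b * v ≠ 0 ∨ c * u + d * v ≠ 0 := by
  by_contra! h0
  have hu : (a * d - b * c) * u = 0 := by linear_combination d * h0.1 - b * h0.2
  have hv : (a * d - b * c) * v = 0 := by linear_combination a * h0.2 - c * h0.1
  rw [mul_eq_zero, or_iff_right hdet] at hu hv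
  simp [hu, hv] at h

/-- The linear forms of distinct points are coprime, their determinants being nonzero, so the
product divides `f`; the degrees agree because the point `∞` contributes the constant `-1`. -/
theorem IsLabelling.exists_eq_prod {C : HyperellipticCurve k}
    {α : Fin (2 * C.genus + 2) → OnePoint k} (hα : C.IsLabelling α) :
    ∃ c, c ≠ 0 ∧ C.f = Polynomial.C c * ∏ i, (Polynomial.C (homY (α i)) * X -
      Polynomial.C (homX (α i))) := by
  classical
  have hbr : ∀ i, α i ∈ C.branchPoints := fun i => hα.range_eq ▸ ⟨i, rfl⟩
  have hf0 : C.f ≠ 0 := C.separable.ne_zero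
  set P : Fin (2 * C.genus + 2) → k[X] := fun i =>
    Polynomial.C (homY (α i)) * X - Polynomial.C (homX (α i)) with hP
  have hne : ∀ i, P i ≠ 0 ∧ (P i).natDegree + (if α i = OnePoint.infty then 1 else 0) = 1 := by
    intro i
    simp only [hP]
    generalize α i = Q
    induction Q using OnePoint.rec with
    | infty => simp
    | coe a => simp [X_sub_C_ne_zero]
  have hdvd : ∏ i, P i ∣ C.f := by
    refine Finset.prod_dvd_of_coprime (fun i _ j _ hij => ?_) fun i _ => ?_
    · have hb := bracket_ne_zero (hα.injective.ne hij)
      refine ⟨Polynomial.C ((bracket (α i) (α j))⁻¹ * -homY (α j)),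
        Polynomial.C ((bracket (α i) (α j))⁻¹ * homY (α i)), ?_⟩
      have : (1 : k[X]) = Polynomial.C ((bracket (α i) (α j))⁻¹ * bracket (α i) (α j)) := by
        rw [inv_mul_cancel₀ hb, C_1]
      rw [this]
      simp only [hP, C_mul, C_neg, bracket, C_sub]
      ring
    · rcases hbr i with ⟨a, ha, hroot⟩ | ⟨ha, -⟩
      · simpa [hP, ha] using dvd_iff_isRoot.mpr hroot
      · simp [hP, ha]
  have hsum : (∏ i, P i).natDegree + (Finset.univ.filter fun i => α i = OnePoint.infty).card =
      2 * C.genus + 2 := by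
    rw [natDegree_prod _ _ fun i _ => (hne i).1, Finset.card_filter, ← Finset.sum_add_distrib,
      Finset.sum_congr rfl fun i _ => (hne i).2]
    simp
  have hcard : (Finset.univ.filter fun i => α i = OnePoint.infty).card ≤ 1 :=
    Finset.card_le_one.mpr fun i hi j hj => hα.injective (by simp_all)
  have hle : C.f.natDegree ≤ (∏ i, P i).natDegree := by
    rcases C.natDegree_f with h | h
    · omega
    · have : (Finset.univ.filter fun i => α i = OnePoint.infty).card = 0 := by
        rw [Finset.card_eq_zero, Finset.filter_eq_empty_iff]
        intro i _ hi
        rcases hbr i with ⟨a, ha, -⟩ | ⟨-, h'⟩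
        · rw [ha] at hi; exact OnePoint.coe_ne_infty a hi
        · omega
      omega
  obtain ⟨q, hq⟩ := hdvd
  have hq0 : q ≠ 0 := by rintro rfl; simp [hf0] at hq
  have hdeg : q.natDegree = 0 := by
    have := congrArg natDegree hq
    rw [natDegree_mul (Finset.prod_ne_zero_iff.mpr fun i _ => (hne i).1) hq0] at this
    omega
  rw [eq_C_of_natDegree_eq_zero hdeg] at hq hq0
  exact ⟨q.coeff 0, by simpa using hq0, by rw [mul_comm]; exact hq⟩

/-- `f` already splits over the algebraically closed field `A`, so no new roots appear in `B`. -/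
theorem IsLabelling.map {K A B : Type*} [Field K] [Field A] [IsAlgClosed A] [Field B] [Algebra K A]
    [Algebra K B] (ι : A →ₐ[K] B) {C : HyperellipticCurve K}
    {α : Fin (2 * C.genus + 2) → OnePoint A} (hα : (C.baseChange A).IsLabelling α) :
    (C.baseChange B).IsLabelling fun i => OnePoint.map ι (α i) := by
  have hf : C.f.map (algebraMap K B) = (C.f.map (algebraMap K A)).map (ι : A →+* B) := by
    rw [Polynomial.map_map]
    congr 1
    exact ι.comp_algebraMap.symm
  refine ⟨(Option.map_injective ι.injective).comp hα.injective, ?_⟩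
  have hr : Set.range (fun i => OnePoint.map ι (α i)) =
      OnePoint.map ι '' (C.baseChange A).branchPoints := by
    rw [← hα.range_eq]
    exact Set.range_comp _ _
  refine hr.trans ?_
  ext P
  induction P using OnePoint.rec with
  | infty =>
    constructor
    · rintro ⟨Q, hQ, hQP⟩
      induction Q using OnePoint.rec with
      | infty =>
        refine Or.inr ⟨rfl, ?_⟩
        rcases hQ with ⟨a, ha, -⟩ | ⟨-, h⟩
        · exact absurd ha (OnePoint.infty_ne_coe a)
        · simpa [baseChange] using h
      | coe a => simp at hQP
    · rintro (⟨a, ha, -⟩ | ⟨-, h⟩)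
      · exact absurd ha (OnePoint.infty_ne_coe a)
      · exact ⟨OnePoint.infty, Or.inr ⟨rfl, by simpa [baseChange] using h⟩, rfl⟩
  | coe b =>
    constructor
    · rintro ⟨Q, hQ, hQP⟩
      induction Q using OnePoint.rec with
      | infty => simp at hQP
      | coe a =>
        rw [OnePoint.map_some, OnePoint.coe_eq_coe] at hQP
        rcases hQ with ⟨a', ha, hroot⟩ | ⟨ha, -⟩
        · rw [OnePoint.coe_eq_coe] at ha
          subst ha
          refine Or.inl ⟨b, rfl, ?_⟩
          change (C.f.map (algebraMap K B)).IsRoot b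
          rw [hf, ← hQP]
          exact IsRoot.map hroot
        · exact absurd ha (OnePoint.coe_ne_infty a)
    · rintro (⟨b', hb, hroot⟩ | ⟨hb, -⟩)
      · rw [OnePoint.coe_eq_coe] at hb
        subst hb
        have hroot' : (C.f.map (algebraMap K B)).IsRoot b := hroot
        have hf0 : C.f.map (algebraMap K B) ≠ 0 := (C.separable.map).ne_zero
        rw [← mem_roots hf0, hf, (IsAlgClosed.splits _).roots_map, Multiset.mem_map] at hroot'
        obtain ⟨a, ha, rfl⟩ := hroot'
        exact ⟨a, Or.inl ⟨a, rfl, isRoot_of_mem_roots ha⟩, rfl⟩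
      · exact absurd hb (OnePoint.coe_ne_infty b)

theorem IsLabelling.exists_of_mobius {C C' : HyperellipticCurve k}
    {α : Fin (2 * C.genus + 2) → OnePoint k} (hα : C.IsLabelling α)
    {α' : Fin (2 * C'.genus + 2) → OnePoint k} (hα' : C'.IsLabelling α')
    {a b c d : k} {s : k[X]} (hdet : a * d - b * c ≠ 0) (hs : s ≠ 0)
    (h : (homForm (2 * C'.genus + 2) C'.f (Polynomial.C a * X + Polynomial.C b)
      (Polynomial.C c * X + Polynomial.C d) : k[X]) = s ^ 2 * C.f) :
    ∃ e : Fin (2 * C.genus + 2) → Fin (2 * C'.genus + 2), Function.Injective e ∧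
      SameCrossRatios α fun i => α' (e i) := by
  have key : ∀ i, ∃ (j : Fin (2 * C'.genus + 2)) (t : k), t ≠ 0 ∧
      a * homX (α i) + b * homY (α i) = t * homX (α' j) ∧
      c * homX (α i) + d * homY (α i) = t * homY (α' j) := by
    intro i
    have hbr : α i ∈ C.branchPoints := hα.range_eq ▸ ⟨i, rfl⟩
    rw [mem_branchPoints_iff] at hbr
    have h0 := homForm_mobius_eq_zero hs C.natDegree_f h hbr
    obtain ⟨Q, t, ht, hx, hy⟩ := exists_onePoint_of_ne_zero
      (linear_ne_zero hdet (homX_ne_zero_or_homY_ne_zero (α i)))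
    rw [hx, hy, homForm_mul] at h0
    have hQ := (mul_eq_zero.mp h0).resolve_left (pow_ne_zero _ ht)
    rw [← mem_branchPoints_iff, ← hα'.range_eq] at hQ
    obtain ⟨j, rfl⟩ := hQ
    exact ⟨j, t, ht, hx, hy⟩
  choose e t ht hxy using key
  refine ⟨e, fun i j hij => ?_, sameCrossRatios_of_linear ht hxy⟩
  -- The Möbius map multiplies determinants by a nonzero number, so distinct branch points have
  -- distinct images.
  by_contra hne
  have hb := bracket_ne_zero (hα.injective.ne hne)
  have hdb : (a * d - b * c) * bracket (α i) (α j) = t i * t j * bracket (α' (e i)) (α' (e j)) := by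
    calc _ = (a * homX (α i) + b * homY (α i)) * (c * homX (α j) + d * homY (α j)) -
          (a * homX (α j) + b * homY (α j)) * (c * homX (α i) + d * homY (α i)) := by
          unfold bracket; ring
      _ = _ := by rw [(hxy i).1, (hxy i).2, (hxy j).1, (hxy j).2]; unfold bracket; ring
  rw [hij, show bracket (α' (e j)) (α' (e j)) = 0 from sub_self _, mul_zero] at hdb
  exact mul_ne_zero hdet hb hdb

end HyperellipticCurve

end Labellings

/-! ### Values of functions at places -/

section Places

variable {k F : Type*} [Field k] [Field F] [Algebra k F]

/-- The function `z` takes the value `c` at the place `P`. -/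
def ValuationSubring.HasValue (P : ValuationSubring F) (z : F) (c : k) : Prop :=
  P.valuation (z - algebraMap k F c) < 1

namespace ValuationSubring

variable {P : ValuationSubring F}

theorem hasValue_algebraMap (P : ValuationSubring F) (c : k) :
    P.HasValue (algebraMap k F c) c := by
  simp [HasValue]

theorem HasValue.add {z w : F} {c d : k} (hz : P.HasValue z c) (hw : P.HasValue w d) :
    P.HasValue (z + w) (c + d) := by
  unfold HasValue at *
  rw [map_add, add_sub_add_comm]
  exact P.valuation.map_add_lt hz hw

theorem HasValue.mul (hP : ∀ c : k, algebraMap k F c ∈ P) {z w : F} {c d : k}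
    (hz : P.HasValue z c) (hw : P.HasValue w d) : P.HasValue (z * w) (c * d) := by
  unfold HasValue at *
  have hc := (P.valuation_le_one_iff _).mpr (hP c)
  have hd := (P.valuation_le_one_iff _).mpr (hP d)
  have hwle : P.valuation w ≤ 1 := by
    rw [← sub_add_cancel w (algebraMap k F d)]
    exact P.valuation.map_add_le hw.le hd
  rw [map_mul, show z * w - algebraMap k F c * algebraMap k F d =
    (z - algebraMap k F c) * w + algebraMap k F c * (w - algebraMap k F d) by ring]
  refine P.valuation.map_add_lt ?_ ?_ <;> rw [map_mul]
  · exact mul_lt_one_of_lt_of_le hz hwle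
  · rw [mul_comm]
    exact mul_lt_one_of_lt_of_le hw hc

/-- A nonzero constant is a unit at `P`, so the difference of two distinct values cannot have
valuation less than 1. -/
theorem HasValue.unique (hP : ∀ c : k, algebraMap k F c ∈ P) {z : F} {c d : k}
    (hc : P.HasValue z c) (hd : P.HasValue z d) : c = d := by
  by_contra hne
  have hsub := P.valuation.map_sub_lt hd hc
  have h1 := (P.valuation_le_one_iff _).mpr (hP (c - d)⁻¹)
  rw [sub_sub_sub_cancel_left, ← map_sub] at hsub
  have h2 : P.valuation (algebraMap k F (c - d)) * P.valuation (algebraMap k F (c - d)⁻¹) = 1 := by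
    rw [← map_mul, ← map_mul, mul_inv_cancel₀ (sub_ne_zero.mpr hne), map_one, map_one]
  exact absurd h2 (mul_lt_one_of_lt_of_le hsub h1).ne

theorem HasValue.aeval (hP : ∀ c : k, algebraMap k F c ∈ P) {z : F} {c : k}
    (hz : P.HasValue z c) (p : k[X]) : P.HasValue (Polynomial.aeval z p) (p.eval c) := by
  induction p using Polynomial.induction_on with
  | C a => simpa using P.hasValue_algebraMap a
  | add p q hp hq => simpa using hp.add hq
  | monomial n a h =>
    have := h.mul hP hz
    simpa [pow_succ, mul_assoc] using this

theorem mem_nonunits_of_mem_nonunits_comap {F' : Type*} [Field F'] {f : F' →+* F} {z : F'}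
    (h : z ∈ (P.comap f).nonunits) : f z ∈ P.nonunits := by
  rw [mem_nonunits_iff_or] at h ⊢
  simpa using h

end ValuationSubring

end Places

/-! ### Isomorphisms and cross ratios of branch points -/

section Main

open IntermediateField

namespace HyperellipticCurve

/-- Each family meets `∞` at most once, so two of them exclude at most two of three indices. -/
theorem exists_ne_infty {ι κ κ' : Type*} {α : ι → OnePoint κ} {β : ι → OnePoint κ'}
    (hα : Function.Injective α) (hβ : Function.Injective β) {i₀ i₁ i₂ : ι} (h01 : i₀ ≠ i₁)
    (h02 : i₀ ≠ i₂) (h12 : i₁ ≠ i₂) : ∃ i, α i ≠ OnePoint.infty ∧ β i ≠ OnePoint.infty := by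
  by_contra! h
  have hA : ∀ {i j}, i ≠ j → α i = OnePoint.infty → α j ≠ OnePoint.infty :=
    fun hij hi hj => hij (hα (hi.trans hj.symm))
  have hB : ∀ {i j}, i ≠ j → β i = OnePoint.infty → β j ≠ OnePoint.infty :=
    fun hij hi hj => hij (hβ (hi.trans hj.symm))
  by_cases h0 : α i₀ = OnePoint.infty
  · exact hB h12 (h _ (hA h01 h0)) (h _ (hA h02 h0))
  · by_cases h1 : α i₁ = OnePoint.infty
    · exact hB h02 (h _ h0) (h _ (hA h12 h1))
    · exact hB h01 (h _ h0) (h _ h1)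

variable {k : Type*} [Field k]

/-- Writing the coordinate function as `x₁ / x₀` with values equal to the homogeneous coordinates of
`a` treats finite points and `∞` alike: `(x, 1)` or `(1, 1/x)`. -/
theorem LiesOver.exists_hasValue {C : HyperellipticCurve k} {F : Type*} [Field F] [Algebra k F]
    (ψ : C.FunctionField →ₐ[k] F) {P : ValuationSubring F} {a : OnePoint k}
    (h : C.LiesOver (P.comap (ψ : C.FunctionField →+* F)) a) :
    ∃ x₁ x₀ : F, x₀ ≠ 0 ∧ x₁ = ψ C.x * x₀ ∧ P.HasValue x₁ (homX a) ∧ P.HasValue x₀ (homY a) ∧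
      (homY a = 1 → x₀ = 1) := by
  rcases h.2 with ⟨b, rfl, hb⟩ | ⟨rfl, hinf⟩
  · refine ⟨ψ C.x, 1, one_ne_zero, (mul_one _).symm, ?_, ?_, fun _ => rfl⟩
    · have := ValuationSubring.mem_nonunits_of_mem_nonunits_comap hb
      rw [ValuationSubring.mem_nonunits_iff] at this
      simpa [ValuationSubring.HasValue] using this
    · simpa using P.hasValue_algebraMap (1 : k)
  · have hx0 : C.x ≠ 0 := fun h0 => C.isQuadraticOver.transcendental (h0 ▸ isAlgebraic_zero)
    have hψ : ψ C.x ≠ 0 := by simpa using hx0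
    refine ⟨1, (ψ C.x)⁻¹, inv_ne_zero hψ, (mul_inv_cancel₀ hψ).symm, ?_, ?_, by simp⟩
    · simpa using P.hasValue_algebraMap (1 : k)
    · have := ValuationSubring.mem_nonunits_of_mem_nonunits_comap hinf
      rw [ValuationSubring.mem_nonunits_iff] at this
      simpa [ValuationSubring.HasValue] using this

/-- The point of the curve of bidegree `(2, 2)` over a common zero of the two discriminants
is singular, so that the first discriminant has a double zero. -/
theorem eval_derivative_biquadraticDiscrim {n : Fin 3 → Fin 3 → k} {p q : k}
    (h0 : (quadraticPoly (n 2)).eval p * q ^ 2 + (quadraticPoly (n 1)).eval p * q +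
      (quadraticPoly (n 0)).eval p = 0)
    (hp : (biquadraticDiscrim n).eval p = 0)
    (hq : (biquadraticDiscrim fun i j => n j i).eval q = 0) :
    (derivative (biquadraticDiscrim n)).eval p = 0 := by
  simp only [biquadraticDiscrim, quadraticPoly, eval_add, eval_sub, eval_mul, eval_pow, eval_C,
    eval_X, eval_ofNat] at h0 hp hq
  -- Up to a multiple of the relation, the square of the partial derivative in either variable is
  -- the discriminant with respect to it, so both partial derivatives vanish at `(p, q)`.
  have hU : 2 * (n 2 2 * p ^ 2 + n 2 1 * p + n 2 0) * q +
      (n 1 2 * p ^ 2 + n 1 1 * p + n 1 0) = 0 := by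
    refine pow_eq_zero_iff (two_ne_zero) |>.mp ?_
    linear_combination hp + 4 * (n 2 2 * p ^ 2 + n 2 1 * p + n 2 0) * h0
  have hX : 2 * (n 2 2 * q ^ 2 + n 1 2 * q + n 0 2) * p +
      (n 2 1 * q ^ 2 + n 1 1 * q + n 0 1) = 0 := by
    refine pow_eq_zero_iff (two_ne_zero) |>.mp ?_
    linear_combination hq + 4 * (n 2 2 * q ^ 2 + n 1 2 * q + n 0 2) * h0
  have hd : (derivative (biquadraticDiscrim n)).eval p =
      2 * (n 1 2 * p ^ 2 + n 1 1 * p + n 1 0) * (2 * n 1 2 * p + n 1 1) -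
      4 * (2 * n 2 2 * p + n 2 1) * (n 0 2 * p ^ 2 + n 0 1 * p + n 0 0) -
      4 * (n 2 2 * p ^ 2 + n 2 1 * p + n 2 0) * (2 * n 0 2 * p + n 0 1) := by
    rw [biquadraticDiscrim_eq]
    simp only [derivative_add, derivative_C_mul, derivative_X_pow, derivative_X, derivative_C,
      eval_add, eval_mul, eval_C, eval_pow, eval_X, eval_zero, eval_one, Nat.cast_ofNat,
      eval_ofNat, C_ofNat]
    ring
  rw [hd]
  -- Where the relation and its `U`-derivative vanish, the derivative of the discriminant is `-4`
  -- times the leading coefficient in `U` times the `X`-derivative.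
  linear_combination 2 * (2 * n 1 2 * p + n 1 1) * hU - 4 * (2 * n 2 2 * p + n 2 1) * h0 +
    4 * (2 * n 2 2 * p + n 2 1) * q * hU -
    4 * (n 2 2 * p ^ 2 + n 2 1 * p + n 2 0) * hX

/-- An isomorphism preserves the cross ratios of the Weierstrass points. -/
theorem Iso.MapsPointsOver.sameCrossRatios (h2 : (2 : k) ≠ 0) {C C' : HyperellipticCurve k}
    {α : Fin (2 * C.genus + 2) → OnePoint k} (hα : C.IsLabelling α)
    {α' : Fin (2 * C'.genus + 2) → OnePoint k} (hα' : C'.IsLabelling α') {φ : Iso C C'}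
    {e : Fin (2 * C.genus + 2) ≃ Fin (2 * C'.genus + 2)}
    (h : φ.MapsPointsOver α (fun m => α' (e m))) :
    SameCrossRatios α (fun m => α' (e m)) := by
  have hC := C.isQuadraticOver
  have hC' := C'.isQuadraticOver.map φ.symm
  have hval : ∀ i, ∃ P : ValuationSubring C.FunctionField,
      (∀ c : k, algebraMap k C.FunctionField c ∈ P) ∧
      (∃ x₁ x₀ : C.FunctionField, x₀ ≠ 0 ∧ x₁ = C.x * x₀ ∧ P.HasValue x₁ (homX (α i)) ∧
        P.HasValue x₀ (homY (α i)) ∧ (homY (α i) = 1 → x₀ = 1)) ∧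
      ∃ u₁ u₀ : C.FunctionField, u₀ ≠ 0 ∧ u₁ = φ.symm C'.x * u₀ ∧
        P.HasValue u₁ (homX (α' (e i))) ∧ P.HasValue u₀ (homY (α' (e i))) ∧
        (homY (α' (e i)) = 1 → u₀ = 1) := by
    intro i
    obtain ⟨P, hP, hP'⟩ := h i
    exact ⟨P, hP.1, LiesOver.exists_hasValue (AlgHom.id k C.FunctionField) (P := P) hP,
      LiesOver.exists_hasValue (φ.symm : C'.FunctionField →ₐ[k] C.FunctionField) hP'⟩
  by_cases hu : φ.symm C'.x ∈ k⟮C.x⟯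
  · obtain ⟨a, b, c, d, hdet, hmob⟩ := hC.exists_mobius hC' hu
    have key : ∀ i, ∃ t : k, t ≠ 0 ∧
        a * homX (α i) + b * homY (α i) = t * homX (α' (e i)) ∧
        c * homX (α i) + d * homY (α i) = t * homY (α' (e i)) := by
      intro i
      obtain ⟨P, hP, ⟨x₁, x₀, -, hx, hx1, hx0, -⟩, u₁, u₀, -, hu, hu1, hu0, -⟩ := hval i
      have hm := fun c : k => P.hasValue_algebraMap c
      have v1 := hu1.mul hP (((hm c).mul hP hx1).add ((hm d).mul hP hx0))
      have v2 := hu0.mul hP (((hm a).mul hP hx1).add ((hm b).mul hP hx0))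
      have heq : u₁ * (algebraMap k _ c * x₁ + algebraMap k _ d * x₀) =
          u₀ * (algebraMap k _ a * x₁ + algebraMap k _ b * x₀) := by
        rw [hu, hx]
        linear_combination u₀ * x₀ * hmob
      rw [heq] at v1
      -- Comparing values at `P` shows that the Möbius image of `α i` and the point `α' (e i)` have
      -- zero determinant, hence coincide.
      have hval := v1.unique hP v2
      obtain ⟨Q, t, ht, h1, h2⟩ := exists_onePoint_of_ne_zero
        (linear_ne_zero hdet (homX_ne_zero_or_homY_ne_zero (α i)))
      have hQ : Q = α' (e i) := by
        by_contra hne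
        apply mul_ne_zero ht (bracket_ne_zero hne)
        rw [h1, h2] at hval
        unfold bracket
        linear_combination -hval
      exact ⟨t, ht, hQ ▸ h1, hQ ▸ h2⟩
    choose t ht hxy using key
    exact sameCrossRatios_of_linear ht hxy
  · exfalso
    obtain ⟨-, -, n, hrel, ⟨s, hs, hsf⟩, t, ht, htf⟩ := hC.exists_biquadratic_relation h2 hC'
      C.separable.squarefree C'.separable.squarefree C.one_le_genus C'.one_le_genus C.natDegree_f
      C'.natDegree_f hu
    obtain ⟨i, hi, hi'⟩ : ∃ i, α i ≠ OnePoint.infty ∧ α' (e i) ≠ OnePoint.infty :=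
      exists_ne_infty hα.injective (hα'.injective.comp e.injective)
        (i₀ := ⟨0, by omega⟩) (i₁ := ⟨1, by omega⟩) (i₂ := ⟨2, by have := C.one_le_genus; omega⟩)
        (by simp) (by simp) (by simp)
    obtain ⟨P, hP, ⟨x₁, x₀, -, hx, hx1, -, hx0⟩, u₁, u₀, -, hu, hu1, -, hu0⟩ := hval i
    have hbr : α i ∈ C.branchPoints := hα.range_eq ▸ ⟨i, rfl⟩
    have hbr' : α' (e i) ∈ C'.branchPoints := hα'.range_eq ▸ ⟨e i, rfl⟩
    obtain ⟨p, hp, hroot⟩ := hbr.resolve_right fun h => hi h.1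
    obtain ⟨q, hq, hroot'⟩ := hbr'.resolve_right fun h => hi' h.1
    rw [hp, homY_coe] at hx0
    rw [hq, homY_coe] at hu0
    rw [hp, homX_coe, hx, hx0 rfl, mul_one] at hx1
    rw [hq, homX_coe, hu, hu0 rfl, mul_one] at hu1
    -- Evaluating the relation at the place shows that `(p, q)` lies on the curve of bidegree (2,
    -- 2).
    have v := (((hx1.aeval hP (quadraticPoly (n 2))).mul hP (hu1.mul hP hu1)).add
      ((hx1.aeval hP (quadraticPoly (n 1))).mul hP hu1)).add (hx1.aeval hP (quadraticPoly (n 0)))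
    rw [← pow_two, hrel] at v
    have hv := v.unique hP (by simpa using P.hasValue_algebraMap (0 : k))
    have hder := eval_derivative_biquadraticDiscrim (p := p) (q := q) (n := n)
      (by rw [← hv]; ring) (by simp [hsf, hroot.eq_zero]) (by simp [htf, hroot'.eq_zero])
    rw [hsf, derivative_C_mul, eval_C_mul, mul_eq_zero, or_iff_right hs] at hder
    exact C.separable.eval₂_derivative_ne_zero (RingHom.id k) (x := p)
      (by simpa [eval₂_id] using hroot.eq_zero) (by simpa [eval₂_id] using hder)

theorem map_homForm_linear {k' : Type*} [Field k'] (ι : k →+* k') (n : ℕ) (f : k[X])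
    (a b c d : k) : (homForm n f (Polynomial.C a * X + Polynomial.C b)
      (Polynomial.C c * X + Polynomial.C d) : k[X]).map ι =
    homForm n (f.map ι) (Polynomial.C (ι a) * X + Polynomial.C (ι b))
      (Polynomial.C (ι c) * X + Polynomial.C (ι d)) := by
  simp [homForm, Polynomial.map_sum]

/-- The Möbius map is defined over `k`, whereas the branch points live in `Ω`; the identity between
the forms is carried over by base change. -/
theorem exists_injective_of_mem {C C' : HyperellipticCurve k} (h2 : (2 : k) ≠ 0) {F : Type*}
    [Field F] [Algebra k F] {x y u v : F} (h : IsQuadraticOver C.f x y) (h' : IsQuadraticOver C'.f u v)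
    (hu : u ∈ k⟮x⟯) {Ω : Type*} [Field Ω] [Algebra k Ω]
    {α : Fin (2 * C.genus + 2) → OnePoint Ω} (hα : (C.baseChange Ω).IsLabelling α)
    {α' : Fin (2 * C'.genus + 2) → OnePoint Ω} (hα' : (C'.baseChange Ω).IsLabelling α') :
    ∃ e : Fin (2 * C.genus + 2) → Fin (2 * C'.genus + 2), Function.Injective e ∧
      SameCrossRatios α fun i => α' (e i) := by
  obtain ⟨a, b, c, d, s, hdet, hs, -, hform⟩ := h.exists_mobius_homForm h2 h'
    C.separable.squarefree (m := C'.genus) (by rcases C'.natDegree_f with h | h <;> omega) hu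
  have hform' := congrArg (Polynomial.map (algebraMap k Ω)) hform
  rw [map_homForm_linear, Polynomial.map_mul, Polynomial.map_pow] at hform'
  refine IsLabelling.exists_of_mobius hα hα' ?_ ?_ hform'
  · rw [← map_mul, ← map_mul, ← map_sub]
    exact (_root_.map_ne_zero _).mpr hdet
  · exact (Polynomial.map_ne_zero_iff (algebraMap k Ω).injective).mpr hs

theorem map_biquadraticDiscrim {k' : Type*} [Field k'] (ι : k →+* k') (n : Fin 3 → Fin 3 → k) :
    (biquadraticDiscrim n).map ι = biquadraticDiscrim fun i j => ι (n i j) := by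
  simp [biquadraticDiscrim, quadraticPoly]

theorem IsLabelling.exists_discrim_eq_prod {C : HyperellipticCurve k} {Ω : Type*}
    [Field Ω] [Algebra k Ω] {α : Fin (2 * C.genus + 2) → OnePoint Ω}
    (hα : (C.baseChange Ω).IsLabelling α) {n : Fin 3 → Fin 3 → k} {s : k} (hs : s ≠ 0)
    (h : biquadraticDiscrim n = Polynomial.C s * C.f) (e : Fin 4 ≃ Fin (2 * C.genus + 2)) :
    ∃ c ≠ 0, (biquadraticDiscrim fun i j => algebraMap k Ω (n i j)) = Polynomial.C c *
      ∏ i, (Polynomial.C (homY (α (e i))) * X - Polynomial.C (homX (α (e i)))) := by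
  obtain ⟨c, hc, hf⟩ := hα.exists_eq_prod
  refine ⟨algebraMap k Ω s * c, mul_ne_zero ((_root_.map_ne_zero _).mpr hs) hc, ?_⟩
  rw [← map_biquadraticDiscrim, h, Polynomial.map_mul, Polynomial.map_C]
  rw [show C.f.map (algebraMap k Ω) = (C.baseChange Ω).f from rfl, hf, C_mul, mul_assoc]
  congr 2
  exact (Equiv.prod_comp e _).symm

/-- The branch points of isomorphic curves have the same cross ratios, after a relabelling. -/
theorem Isomorphic.exists_sameCrossRatios (h2 : (2 : k) ≠ 0) {C C' : HyperellipticCurve k}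
    (h : C.Isomorphic C') {Ω : Type*} [Field Ω] [Algebra k Ω]
    {α : Fin (2 * C.genus + 2) → OnePoint Ω} (hα : (C.baseChange Ω).IsLabelling α)
    {α' : Fin (2 * C'.genus + 2) → OnePoint Ω} (hα' : (C'.baseChange Ω).IsLabelling α') :
    ∃ e : Fin (2 * C.genus + 2) ≃ Fin (2 * C'.genus + 2), SameCrossRatios α fun i => α' (e i) := by
  obtain ⟨φ⟩ := h
  have hC := C.isQuadraticOver
  have hC' := C'.isQuadraticOver.map φ.symm
  by_cases hu : φ.symm C'.x ∈ k⟮C.x⟯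
  · obtain ⟨e, he, hcr⟩ := exists_injective_of_mem h2 hC hC' hu hα hα'
    -- The map in the other direction serves only to compare cardinalities, which makes `e`
    -- bijective.
    obtain ⟨e', he', -⟩ := exists_injective_of_mem h2 hC' hC (hC.mem_adjoin_of_mem_adjoin hC' hu)
      hα' hα
    have hbij : Function.Bijective e := (Fintype.bijective_iff_injective_and_card e).mpr
      ⟨he, (Fintype.card_le_of_injective e he).antisymm (Fintype.card_le_of_injective e' he')⟩
    exact ⟨Equiv.ofBijective e hbij, hcr⟩
  · obtain ⟨hg, hg', n, -, ⟨s, hs, hsf⟩, t, ht, htf⟩ := hC.exists_biquadratic_relation h2 hC'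
      C.separable.squarefree C'.separable.squarefree C.one_le_genus C'.one_le_genus C.natDegree_f
      C'.natDegree_f hu
    let e₁ : Fin 4 ≃ Fin (2 * C.genus + 2) := finCongr (by omega)
    let e₂ : Fin 4 ≃ Fin (2 * C'.genus + 2) := finCongr (by omega)
    obtain ⟨c, -, hcD⟩ := hα.exists_discrim_eq_prod hs hsf e₁
    obtain ⟨d, hd, hdD⟩ := hα'.exists_discrim_eq_prod ht htf e₂
    obtain ⟨σ, hσ⟩ := exists_perm_of_biquadraticDiscrim hd hcD hdD
    refine ⟨e₁.symm.trans (σ.trans e₂), ?_⟩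
    simpa using hσ.comp e₁.symm.injective

end HyperellipticCurve

end Main

/-! ### Symmetric roots of isomorphic curves -/

theorem mainTheorem6 {K : Type*} [Field K] (hK : ringChar K ≠ 2)
    (C C' : HyperellipticCurve K)
    (α : Fin (2 * C.genus + 2) → OnePoint (AlgebraicClosure K))
    (hα : (C.baseChange (AlgebraicClosure K)).IsLabelling α)
    (α' : Fin (2 * C'.genus + 2) → OnePoint (AlgebraicClosure K))
    (hα' : (C'.baseChange (AlgebraicClosure K)).IsLabelling α') :
    -- isomorphic curves have the same symmetric roots, after a relabelling
    (∀ (L : Type*) [Field L] [Algebra K L],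
      HyperellipticCurve.Isomorphic (C.baseChange L) (C'.baseChange L) →
      ∃ e : Fin (2 * C.genus + 2) ≃ Fin (2 * C'.genus + 2),
        ∀ i j, i ≠ j →
          symmetricRootFamilies C.genus α i j =
            symmetricRootFamilies C'.genus (fun m => α' (e m)) i j) ∧
    -- the relabelling is the one given by the Weierstrass points
    (∀ (φ : HyperellipticCurve.Iso (C.baseChange (AlgebraicClosure K))
        (C'.baseChange (AlgebraicClosure K)))
      (e : Fin (2 * C.genus + 2) ≃ Fin (2 * C'.genus + 2)),
      φ.MapsPointsOver α (fun m => α' (e m)) →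
        ∀ i j, i ≠ j →
          symmetricRootFamilies C.genus α i j =
            symmetricRootFamilies C'.genus (fun m => α' (e m)) i j) := by
  have h2K : (2 : K) ≠ 0 := Ring.two_ne_zero hK
  have hfam : ∀ e : Fin (2 * C.genus + 2) ≃ Fin (2 * C'.genus + 2),
      SameCrossRatios α (fun m => α' (e m)) → ∀ i j, i ≠ j →
        symmetricRootFamilies C.genus α i j =
          symmetricRootFamilies C'.genus (fun m => α' (e m)) i j := by
    intro e h i j hij
    have hg : C'.genus = C.genus := by
      have := Fintype.card_congr e
      simp only [Fintype.card_fin] at this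
      omega
    exact (symmetricRootFamilies_eq C.one_le_genus (Fintype.card_fin _) hα.injective
      (hα'.injective.comp e.injective) h hij).trans
      (congrArg (fun g => symmetricRootFamilies g (fun m => α' (e m)) i j) hg.symm)
  refine ⟨fun L _ _ hiso => ?_, fun φ e h => hfam e (h.sameCrossRatios ?_ hα hα')⟩
  · have h2L : (2 : L) ≠ 0 := by
      have := (map_ne_zero (algebraMap K L)).mpr h2K
      rwa [map_ofNat] at this
    -- The cross ratios are compared in an algebraic closure of `L`, and equality descends along the
    -- embedding by injectivity.
    let ι : AlgebraicClosure K →ₐ[K] AlgebraicClosure L := IsAlgClosed.lift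
    -- The two base changes to the closure of `L` are equal curves; to keep the index type of the
    -- labelling, that equality enters only through the sets of branch points.
    have hlab : ∀ {D : HyperellipticCurve K} {β : Fin (2 * D.genus + 2) → OnePoint _},
        (D.baseChange (AlgebraicClosure K)).IsLabelling β →
        ((D.baseChange L).baseChange (AlgebraicClosure L)).IsLabelling
          fun i => OnePoint.map ι (β i) := fun {D β} hβ =>
      ⟨(hβ.map ι).injective, (hβ.map ι).range_eq.trans
        (congrArg HyperellipticCurve.branchPoints D.baseChange_baseChange.symm)⟩
    obtain ⟨e, he⟩ := hiso.exists_sameCrossRatios h2L (hlab hα) (hlab hα')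
    exact ⟨e, hfam e (SameCrossRatios.of_map (ι : AlgebraicClosure K →+* AlgebraicClosure L) he)⟩
  · have := (map_ne_zero (algebraMap K (AlgebraicClosure K))).mpr h2K
    rwa [map_ofNat] at this
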